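/- Let $\mathfrak{ns}(2)$ be the $N=2$ Neveu-Schwarz Lie superalgebra, with basis $L_n, J_n$ ($n\in\mathbb{Z}$), $G^\pm_r$ ($r\in\mathbb{Z}+\frac12$), $C$, where $L_n,J_n,C$ are even, $G^\pm_r$ are odd, $C$ is central, and $$[L_m,L_n]=(m-n)L_{m+n}+\tfrac{C}{12}(m^3-m)\delta_{m+n,0},\quad [J_m,J_n]=\tfrac{C}{3}m\,\delta_{m+n,0},\quad [L_m,J_n]=-nJ_{m+n},$$ $$[L_m,G^\pm_r]=(\tfrac m2-r)G^\pm_{m+r},\quad [J_m,G^\pm_r]=\pm G^\pm_{m+r},\quad [G^\pm_r,G^\pm_s]=0,$$ $$[G^+_r,G^-_s]=2L_{r+s}+(r-s)J_{r+s}+\tfrac C3(r^2-\tfrac14)\delta_{r+s,0}.$$ For $c,h,q\in\mathbb{C}$ let $L(c,h,q)$ be the irreducible quotient of the Verma module generated by a lowest weight vector $\mathbf{1}_{c,h,q}$ that is annihilated by $L_n,J_n$ ($n>0$) and $G^\pm_r$ ($r>0$), and on which $L_0$, $J_0$, $C$ act as $h$, $q$, $c$. For an integer $m\ge 0$ put $c_m=\frac{3m}{m+2}$,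 and equip $L(c_m,0,0)$ with its $N=2$ superconformal vertex operator superalgebra structure, that is, the one with vacuum $\mathbf 1=\mathbf 1_{c_m,0,0}$, $\tau^\pm=G^\pm_{-3/2}\mathbf 1$, $\mu=J_{-1}\mathbf 1$, $\omega=L_{-2}\mathbf 1$ and $$Y(\tau^\pm,x)=\sum_{r}G^\pm_r x^{-r-3/2},\qquad Y(\mu,x)=\sum_n J_nx^{-n-1},\qquad Y(\omega,x)=\sum_nL_nx^{-n-2}.$$ For $i=1,2,3$ let $j_i,k_i\in\{\frac12,\frac32,\frac52,\dots\}$ with $j_i+k_i<m+2$, put $h_i=\frac{j_ik_i-1/4}{m+2}$ and $q_i=\frac{j_i-k_i}{m+2}$, and regard $L(c_m,h_i,q_i)$ as an irreducible $L(c_m,0,0)$-module, the vertex operators of $\tau^\pm,\mu,\omega$ being given by the action of $\mathfrak{ns}(2)$ through the same formulas. Suppose that $L(c_m,h_1,q_1)$ is chiral or anti-chiral, i.e. $G^+_{-1/2}\mathbf 1_{c_m,h_1,q_1}=0$ or $G^-_{-1/2}\mathbf 1_{c_m,h_1,q_1}=0$ in $L(c_m,h_1,q_1)$. Then the vector space of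 intertwining operators of type $$\binom{L(c_m,h_3,q_3)}{L(c_m,h_1,q_1)\;\;L(c_m,h_2,q_2)}$$ for the vertex operator superalgebra $L(c_m,0,0)$ has dimension at most $1$. -/

import Mathlib

noncomputable section

namespace NTwo

/-! ### The Neveu-Schwarz Lie superalgebra `ns(2)` and its lowest weight modules -/

/-- Basis of the `N = 2` Neveu-Schwarz Lie superalgebra. The odd elements are indexed by integers:
`Gp k` is `G⁺_{k + 1/2}` and `Gm k` is `G⁻_{k + 1/2}`. `C` is the central element. -/
inductive NSBasis : Type
  | L (n : ℤ)
  | J (n : ℤ)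
  | Gp (k : ℤ)
  | Gm (k : ℤ)
  | C

/-- The free associative algebra on the basis of `ns(2)`. -/
abbrev NSFree : Type := FreeAlgebra ℂ NSBasis

namespace NSFree

def L (n : ℤ) : NSFree := FreeAlgebra.ι ℂ (NSBasis.L n)
def J (n : ℤ) : NSFree := FreeAlgebra.ι ℂ (NSBasis.J n)
def Gp (k : ℤ) : NSFree := FreeAlgebra.ι ℂ (NSBasis.Gp k)
def Gm (k : ℤ) : NSFree := FreeAlgebra.ι ℂ (NSBasis.Gm k)
def C : NSFree := FreeAlgebra.ι ℂ NSBasis.C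

end NSFree

open NSFree in
/-- The defining relations of the universal enveloping algebra of `ns(2)`: the superbracket of two
basis elements is their commutator, or their anticommutator if both are odd. -/
inductive NSRel : NSFree → NSFree → Prop
  | central (x : NSBasis) : NSRel (C * FreeAlgebra.ι ℂ x) (FreeAlgebra.ι ℂ x * C)
  | LL (m n : ℤ) : NSRel (L m * L n - L n * L m)
      (((m : ℂ) - n) • L (m + n) + (if m + n = 0 then (((m : ℂ) ^ 3 - m) / 12) • C else 0))
  | JJ (m n : ℤ) : NSRel (J m * J n - J n * J m)
      (if m + n = 0 then ((m : ℂ) / 3) • C else 0)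
  | LJ (m n : ℤ) : NSRel (L m * J n - J n * L m) ((-(n : ℂ)) • J (m + n))
  | LGp (m k : ℤ) : NSRel (L m * Gp k - Gp k * L m) (((m : ℂ) / 2 - (k + 1 / 2)) • Gp (m + k))
  | LGm (m k : ℤ) : NSRel (L m * Gm k - Gm k * L m) (((m : ℂ) / 2 - (k + 1 / 2)) • Gm (m + k))
  | JGp (m k : ℤ) : NSRel (J m * Gp k - Gp k * J m) (Gp (m + k))
  | JGm (m k : ℤ) : NSRel (J m * Gm k - Gm k * J m) (-Gm (m + k))
  | GpGm (k l : ℤ) : NSRel (Gp k * Gm l + Gm l * Gp k)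
      ((2 : ℂ) • L (k + l + 1) + ((k : ℂ) - l) • J (k + l + 1) +
        (if k + l + 1 = 0 then ((((k : ℂ) + 1 / 2) ^ 2 - 1 / 4) / 3) • C else 0))
  | GpGp (k l : ℤ) : NSRel (Gp k * Gp l + Gp l * Gp k) 0
  | GmGm (k l : ℤ) : NSRel (Gm k * Gm l + Gm l * Gm k) 0

/-- The universal enveloping algebra `U(ns(2))`. Its modules are the representations of `ns(2)`. -/
abbrev UNS : Type := RingQuot NSRel

namespace UNS

/-- The image of a basis element in the enveloping algebra. -/
def of (x : NSBasis) : UNS := RingQuot.mkAlgHom ℂ NSRel (FreeAlgebra.ι ℂ x)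

def L (n : ℤ) : UNS := of (NSBasis.L n)
def J (n : ℤ) : UNS := of (NSBasis.J n)
/-- `Gp k` is `G⁺_{k + 1/2}`. -/
def Gp (k : ℤ) : UNS := of (NSBasis.Gp k)
/-- `Gm k` is `G⁻_{k + 1/2}`. -/
def Gm (k : ℤ) : UNS := of (NSBasis.Gm k)
def C : UNS := of NSBasis.C

end UNS

/-- The left ideal that annihilates the generator of the Verma module of lowest weight
`(c, h, q)`. -/
def vermaIdeal (c h q : ℂ) : Submodule UNS UNS :=
  Submodule.span UNS
    ({x | ∃ n : ℤ, 0 < n ∧ (x = UNS.L n ∨ x = UNS.J n)} ∪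
     {x | ∃ k : ℤ, 0 ≤ k ∧ (x = UNS.Gp k ∨ x = UNS.Gm k)} ∪
     {UNS.L 0 - algebraMap ℂ UNS h, UNS.J 0 - algebraMap ℂ UNS q, UNS.C - algebraMap ℂ UNS c})

/-- The Verma module `M(c, h, q)`. -/
abbrev Verma (c h q : ℂ) : Type := UNS ⧸ vermaIdeal c h q

/-- The maximal proper submodule of the Verma module, as the sum of all proper submodules. -/
def maxProper (c h q : ℂ) : Submodule UNS (Verma c h q) :=
  sSup {N | N ≠ ⊤}

/-- The irreducible lowest weight module `L(c, h, q)`. -/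
abbrev Irr (c h q : ℂ) : Type := Verma c h q ⧸ maxProper c h q

/-- The lowest weight vector of `L(c, h, q)`, the image of `1 ∈ U(ns(2))`. -/
def Irr.lowest (c h q : ℂ) : Irr c h q :=
  (maxProper c h q).mkQ ((vermaIdeal c h q).mkQ 1)

/-- `L(c, h, q)` is chiral: `G⁺(-1/2)` kills the lowest weight vector. -/
def IsChiral (c h q : ℂ) : Prop := UNS.Gp (-1) • Irr.lowest c h q = 0

/-- `L(c, h, q)` is anti-chiral: `G⁻(-1/2)` kills the lowest weight vector. -/
def IsAntiChiral (c h q : ℂ) : Prop := UNS.Gm (-1) • Irr.lowest c h q = 0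

/-! ### Vertex operator superalgebras, modules, intertwining operators -/

/-- The Jacobi identity
`x₀⁻¹δ((x₁-x₂)/x₀) a₃(x₁) 𝒴(w₁,x₂)w₂ - ε x₀⁻¹δ((x₂-x₁)/(-x₀)) 𝒴(w₁,x₂) a₂(x₁)w₂
  = x₂⁻¹δ((x₁-x₀)/x₂) 𝒴(a₁(x₀)w₁,x₂)w₂`
for fields `aᵢ(x) = ∑ₙ aᵢ(n) x^{-n-1}` (`n ∈ ℤ`) and `𝒴(w,x) = ∑ₖ w_k x^{-k-1}` (`k ∈ K`, where `K`
is `ℤ` or `ℂ`), written as the equality of the coefficients of `x₀^{-r-1} x₁^{-p-1} x₂^{-k-1}` for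
all `r`, `p`, `k`. The sums are finite when the fields satisfy the truncation conditions. -/
def JacobiIdentity {K W₁ W₂ W₃ : Type*} [Ring K] [AddCommGroup W₁] [Module ℂ W₁]
    [AddCommGroup W₂] [Module ℂ W₂] [AddCommGroup W₃] [Module ℂ W₃] (ε : ℂ)
    (a₁ : ℤ → W₁ →ₗ[ℂ] W₁) (a₂ : ℤ → W₂ →ₗ[ℂ] W₂) (a₃ : ℤ → W₃ →ₗ[ℂ] W₃)
    (𝒴 : W₁ →ₗ[ℂ] K → W₂ →ₗ[ℂ] W₃) (w₁ : W₁) (w₂ : W₂) : Prop :=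
  ∀ (r p : ℤ) (k : K),
    ∑ᶠ i : ℕ, ((-1 : ℂ) ^ i * (Ring.choose r i : ℂ)) •
      (a₃ (p + r - i) (𝒴 w₁ (k + i) w₂)
        - (ε * (-1 : ℂ) ^ r) • 𝒴 w₁ (k + r - i) (a₂ (p + i) w₂))
    = ∑ᶠ i : ℕ, (Ring.choose p i : ℂ) • 𝒴 (a₁ (r + i) w₁) (k + p - i) w₂

/-- The sign `(-1)^{ij}` for parities `i`, `j`. -/
def parSign (i j : ZMod 2) : ℂ := (-1) ^ (i.val * j.val)

/-- Vertex operator superalgebras (over `ℂ`). `Y u n` is the mode `u_n` in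
`Y(u, x) = ∑ₙ u_n x^{-n-1}`. -/
structure VOSA (V : Type*) [AddCommGroup V] [Module ℂ V] where
  /-- even (`par 0`) and odd (`par 1`) subspaces -/
  par : ZMod 2 → Submodule ℂ V
  isCompl_par : IsCompl (par 0) (par 1)
  Y : V →ₗ[ℂ] ℤ → V →ₗ[ℂ] V
  one : V
  omega : V
  centralCharge : ℂ
  one_mem : one ∈ par 0
  omega_mem : omega ∈ par 0
  par_Y : ∀ (i j : ZMod 2) (u v : V) (n : ℤ), u ∈ par i → v ∈ par j → Y u n v ∈ par (i + j)
  truncation : ∀ u v : V, ∃ N : ℤ, ∀ n : ℤ, N ≤ n → Y u n v = 0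
  vacuum : ∀ (n : ℤ) (v : V), Y one n v = if n = -1 then v else 0
  creation : ∀ v : V, Y v (-1) one = v ∧ ∀ n : ℤ, 0 ≤ n → Y v n one = 0
  jacobi : ∀ (i j : ZMod 2) (u v w : V), u ∈ par i → v ∈ par j →
    JacobiIdentity (parSign i j) (Y u) (Y u) (Y u) Y v w
  /-- the operators `L(n)`, the modes `ω_{n+1}`, satisfy the Virasoro relations -/
  virasoro : ∀ (m n : ℤ) (v : V),
    Y omega (m + 1) (Y omega (n + 1) v) - Y omega (n + 1) (Y omega (m + 1) v)
      = ((m : ℂ) - n) • Y omega (m + n + 1) v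
        + if m + n = 0 then ((centralCharge / 12) * ((m : ℂ) ^ 3 - m)) • v else 0
  /-- `L(-1)`-derivative property -/
  derivative : ∀ (u : V) (n : ℤ), Y (Y omega 0 u) n = (-(n : ℂ)) • Y u (n - 1)
  /-- `V` is the (automatically direct) sum of the weight spaces `V_(n)`, `n ∈ ℤ/2` -/
  weights : ⨆ n : ℤ, Module.End.eigenspace (Y omega 1) ((n : ℂ) / 2) = ⊤
  weights_finite : ∀ n : ℤ,
    FiniteDimensional ℂ (Module.End.eigenspace (Y omega 1) ((n : ℂ) / 2))
  weights_bounded : ∃ N : ℤ, ∀ n : ℤ, n < N →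
    Module.End.eigenspace (Y omega 1) ((n : ℂ) / 2) = ⊥

/-- `N = 2` superconformal vertex operator superalgebras. The modes of `τ⁺`, `τ⁻`, `μ`, `ω` are
`G^±(r) = τ^±_{r + 1/2}`, `J(n) = μ_n`, `L(n) = ω_{n+1}`; again `k` stands for `r = k + 1/2`. -/
structure SuperconformalVOSA (V : Type*) [AddCommGroup V] [Module ℂ V] extends VOSA V where
  tauP : V
  tauM : V
  mu : V
  tauP_mem : tauP ∈ par 1
  tauM_mem : tauM ∈ par 1
  mu_mem : mu ∈ par 0
  /-- `V` is the (automatically direct) sum of eigenspaces of `J(0)` with integral eigenvalues -/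
  charges : ⨆ n : ℤ, Module.End.eigenspace (Y mu 0) (n : ℂ) = ⊤
  par_eq : ∀ i : ZMod 2,
    par i = ⨆ n : {n : ℤ // (n : ZMod 2) = i}, Module.End.eigenspace (Y mu 0) ((n : ℤ) : ℂ)
  JJ : ∀ (m n : ℤ) (v : V), Y mu m (Y mu n v) - Y mu n (Y mu m v)
    = if m + n = 0 then (centralCharge / 3 * m) • v else 0
  LJ : ∀ (m n : ℤ) (v : V), Y omega (m + 1) (Y mu n v) - Y mu n (Y omega (m + 1) v)
    = (-(n : ℂ)) • Y mu (m + n) v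
  LGp : ∀ (m k : ℤ) (v : V), Y omega (m + 1) (Y tauP (k + 1) v) - Y tauP (k + 1) (Y omega (m + 1) v)
    = ((m : ℂ) / 2 - (k + 1 / 2)) • Y tauP (m + k + 1) v
  LGm : ∀ (m k : ℤ) (v : V), Y omega (m + 1) (Y tauM (k + 1) v) - Y tauM (k + 1) (Y omega (m + 1) v)
    = ((m : ℂ) / 2 - (k + 1 / 2)) • Y tauM (m + k + 1) v
  JGp : ∀ (m k : ℤ) (v : V), Y mu m (Y tauP (k + 1) v) - Y tauP (k + 1) (Y mu m v)
    = Y tauP (m + k + 1) v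
  JGm : ∀ (m k : ℤ) (v : V), Y mu m (Y tauM (k + 1) v) - Y tauM (k + 1) (Y mu m v)
    = -Y tauM (m + k + 1) v
  GpGm : ∀ (k l : ℤ) (v : V), Y tauP (k + 1) (Y tauM (l + 1) v) + Y tauM (l + 1) (Y tauP (k + 1) v)
    = (2 : ℂ) • Y omega (k + l + 2) v + ((k : ℂ) - l) • Y mu (k + l + 1) v
      + if k + l + 1 = 0 then (centralCharge / 3 * (((k : ℂ) + 1 / 2) ^ 2 - 1 / 4)) • v else 0
  GpGp : ∀ (k l : ℤ) (v : V),
    Y tauP (k + 1) (Y tauP (l + 1) v) + Y tauP (l + 1) (Y tauP (k + 1) v) = 0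
  GmGm : ∀ (k l : ℤ) (v : V),
    Y tauM (k + 1) (Y tauM (l + 1) v) + Y tauM (l + 1) (Y tauM (k + 1) v) = 0

/-- Modules for a vertex operator superalgebra, graded by complex weights (the eigenvalues of
`L(0)`) and by a sign. -/
structure VOSAModule {V : Type*} [AddCommGroup V] [Module ℂ V] (A : VOSA V)
    (W : Type*) [AddCommGroup W] [Module ℂ W] where
  par : ZMod 2 → Submodule ℂ W
  isCompl_par : IsCompl (par 0) (par 1)
  Y : V →ₗ[ℂ] ℤ → W →ₗ[ℂ] W
  par_Y : ∀ (i j : ZMod 2) (u : V) (w : W) (n : ℤ),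
    u ∈ A.par i → w ∈ par j → Y u n w ∈ par (i + j)
  truncation : ∀ (u : V) (w : W), ∃ N : ℤ, ∀ n : ℤ, N ≤ n → Y u n w = 0
  vacuum : ∀ (n : ℤ) (w : W), Y A.one n w = if n = -1 then w else 0
  jacobi : ∀ (i j : ZMod 2) (u v : V) (w : W), u ∈ A.par i → v ∈ A.par j →
    JacobiIdentity (parSign i j) (A.Y u) (Y u) (Y u) Y v w
  derivative : ∀ (u : V) (n : ℤ), Y (A.Y A.omega 0 u) n = (-(n : ℂ)) • Y u (n - 1)
  weights : ⨆ a : ℂ, Module.End.eigenspace (Y A.omega 1) a = ⊤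
  weights_finite : ∀ a : ℂ, FiniteDimensional ℂ (Module.End.eigenspace (Y A.omega 1) a)
  weights_bounded : ∃ N : ℝ, ∀ a : ℂ, a.re < N → Module.End.eigenspace (Y A.omega 1) a = ⊥

section Intertwining

variable {V W₁ W₂ W₃ : Type*} [AddCommGroup V] [Module ℂ V]
  [AddCommGroup W₁] [Module ℂ W₁] [AddCommGroup W₂] [Module ℂ W₂] [AddCommGroup W₃] [Module ℂ W₃]
  {A : VOSA V}

/-- Intertwining operators of type `(W₃; W₁ W₂)`; `𝒴 w n` is the mode `w_n`, `n ∈ ℂ`, in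
`𝒴(w, x) = ∑ₙ w_n x^{-n-1}`. -/
structure IsIntertwining (M₁ : VOSAModule A W₁) (M₂ : VOSAModule A W₂) (M₃ : VOSAModule A W₃)
    (𝒴 : W₁ →ₗ[ℂ] ℂ → W₂ →ₗ[ℂ] W₃) : Prop where
  truncation : ∀ (w₁ : W₁) (w₂ : W₂), ∃ N : ℝ, ∀ n : ℂ, N ≤ n.re → 𝒴 w₁ n w₂ = 0
  jacobi : ∀ (i j : ZMod 2) (u : V) (w₁ : W₁) (w₂ : W₂), u ∈ A.par i → w₁ ∈ M₁.par j →
    JacobiIdentity (parSign i j) (M₁.Y u) (M₂.Y u) (M₃.Y u) 𝒴 w₁ w₂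
  derivative : ∀ (w₁ : W₁) (n : ℂ), 𝒴 (M₁.Y A.omega 0 w₁) n = (-n) • 𝒴 w₁ (n - 1)

theorem finite_support_of_le {X : Type*} [AddCommGroup X] {f : ℕ → X} (N : ℕ)
    (h : ∀ i, N ≤ i → f i = 0) : (Function.support f).Finite := by
  refine (Set.finite_Iio N).subset fun i hi => ?_
  by_contra hc
  exact hi (h i (by simpa using hc))

theorem jacobi_left_finite (M₂ : VOSAModule A W₂) (M₃ : VOSAModule A W₃)
    {𝒴 : W₁ →ₗ[ℂ] ℂ → W₂ →ₗ[ℂ] W₃}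
    (ht : ∀ (w₁ : W₁) (w₂ : W₂), ∃ N : ℝ, ∀ n : ℂ, N ≤ n.re → 𝒴 w₁ n w₂ = 0)
    (ε : ℂ) (u : V) (w₁ : W₁) (w₂ : W₂) (r p : ℤ) (k : ℂ) :
    (Function.support fun i : ℕ => ((-1 : ℂ) ^ i * (Ring.choose r i : ℂ)) •
      (M₃.Y u (p + r - i) (𝒴 w₁ (k + i) w₂)
        - (ε * (-1 : ℂ) ^ r) • 𝒴 w₁ (k + r - i) (M₂.Y u (p + i) w₂))).Finite := by
  obtain ⟨N, hN⟩ := ht w₁ w₂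
  obtain ⟨N', hN'⟩ := M₂.truncation u w₂
  refine finite_support_of_le (max (Nat.ceil (N - k.re)) (N' - p).toNat) fun i hi => ?_
  have h1 : N - k.re ≤ i := Nat.ceil_le.1 ((le_max_left _ _).trans hi)
  have h2 : (N' - p).toNat ≤ i := (le_max_right _ _).trans hi
  rw [hN _ (by simp; linarith), hN' _ (by omega)]
  simp

theorem jacobi_right_finite (M₁ : VOSAModule A W₁) (𝒴 : W₁ →ₗ[ℂ] ℂ → W₂ →ₗ[ℂ] W₃)
    (u : V) (w₁ : W₁) (w₂ : W₂) (r p : ℤ) (k : ℂ) :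
    (Function.support fun i : ℕ =>
      (Ring.choose p i : ℂ) • 𝒴 (M₁.Y u (r + i) w₁) (k + p - i) w₂).Finite := by
  obtain ⟨N, hN⟩ := M₁.truncation u w₁
  refine finite_support_of_le (N - r).toNat fun i hi => ?_
  rw [hN _ (by omega)]
  simp

/-- The vector space of intertwining operators of type `(W₃; W₁ W₂)`. -/
def intertwiningOperators (M₁ : VOSAModule A W₁) (M₂ : VOSAModule A W₂) (M₃ : VOSAModule A W₃) :
    Submodule ℂ (W₁ →ₗ[ℂ] ℂ → W₂ →ₗ[ℂ] W₃) where
  carrier := {𝒴 | IsIntertwining M₁ M₂ M₃ 𝒴}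
  zero_mem' := by
    refine ⟨fun _ _ => ⟨0, fun _ _ => rfl⟩, fun i j u w₁ w₂ _ _ r p k => ?_, fun w₁ n => ?_⟩
    · simp
    · simp
  add_mem' := by
    rintro 𝒴 𝒵 ha hb
    refine ⟨fun w₁ w₂ => ?_, fun i j u w₁ w₂ hu hw r p k => ?_, fun w₁ n => ?_⟩
    · obtain ⟨N, hN⟩ := ha.truncation w₁ w₂
      obtain ⟨N', hN'⟩ := hb.truncation w₁ w₂
      refine ⟨max N N', fun n hn => ?_⟩
      simp [hN n ((le_max_left _ _).trans hn), hN' n ((le_max_right _ _).trans hn)]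
    · have h1 := ha.jacobi i j u w₁ w₂ hu hw r p k
      have h2 := hb.jacobi i j u w₁ w₂ hu hw r p k
      have h3 := congrArg₂ (· + ·) h1 h2
      rw [← finsum_add_distrib (jacobi_left_finite M₂ M₃ ha.truncation _ u w₁ w₂ r p k)
          (jacobi_left_finite M₂ M₃ hb.truncation _ u w₁ w₂ r p k),
        ← finsum_add_distrib (jacobi_right_finite M₁ 𝒴 u w₁ w₂ r p k)
          (jacobi_right_finite M₁ 𝒵 u w₁ w₂ r p k)] at h3
      convert h3 using 3 with i i
      · simp only [LinearMap.add_apply, Pi.add_apply, map_add, smul_add, smul_sub]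
        abel
      · simp only [LinearMap.add_apply, Pi.add_apply, smul_add]
    · simp only [LinearMap.add_apply, Pi.add_apply, ha.derivative, hb.derivative, smul_add]
  smul_mem' := by
    rintro t 𝒴 ha
    refine ⟨fun w₁ w₂ => ?_, fun i j u w₁ w₂ hu hw r p k => ?_, fun w₁ n => ?_⟩
    · obtain ⟨N, hN⟩ := ha.truncation w₁ w₂
      exact ⟨N, fun n hn => by simp [hN n hn]⟩
    · have h1 := congrArg (t • ·) (ha.jacobi i j u w₁ w₂ hu hw r p k)
      rw [smul_finsum, smul_finsum] at h1
      convert h1 using 3 with i i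
      · simp only [LinearMap.smul_apply, Pi.smul_apply, map_smul, smul_sub, smul_smul]
        congr 2 <;> ring
      · simp only [LinearMap.smul_apply, Pi.smul_apply, smul_smul]
        congr 1; ring
    · simp only [LinearMap.smul_apply, Pi.smul_apply, ha.derivative]
      rw [smul_comm]

end Intertwining

/-! ### The vertex operator superalgebra `L(c, 0, 0)` and its modules `L(c, h, q)` -/

/-- The `N = 2` superconformal vertex operator superalgebra structure on `L(c, 0, 0)`: the vacuum is
the lowest weight vector, `τ^± = G^±(-3/2)1`, `μ = J(-1)1`, `ω = L(-2)1`, and the modes of these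
elements are the operators by which `ns(2)` acts. (These generate `L(c, 0, 0)`, so the whole
structure is determined.) -/
structure IrrVOSA (c : ℂ) extends SuperconformalVOSA (Irr c 0 0) where
  centralCharge_eq : centralCharge = c
  one_eq : one = Irr.lowest c 0 0
  tauP_eq : tauP = UNS.Gp (-2) • Irr.lowest c 0 0
  tauM_eq : tauM = UNS.Gm (-2) • Irr.lowest c 0 0
  mu_eq : mu = UNS.J (-1) • Irr.lowest c 0 0
  omega_eq : omega = UNS.L (-2) • Irr.lowest c 0 0
  Y_tauP : ∀ (k : ℤ) (v : Irr c 0 0), Y tauP (k + 1) v = UNS.Gp k • v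
  Y_tauM : ∀ (k : ℤ) (v : Irr c 0 0), Y tauM (k + 1) v = UNS.Gm k • v
  Y_mu : ∀ (n : ℤ) (v : Irr c 0 0), Y mu n v = UNS.J n • v
  Y_omega : ∀ (n : ℤ) (v : Irr c 0 0), Y omega (n + 1) v = UNS.L n • v

/-- The `L(c, 0, 0)`-module structure on `L(c, h, q)`: the modes of the generating elements of
`L(c, 0, 0)` are the operators by which `ns(2)` acts (which determines the vertex operators). -/
structure IrrVOSAModule {c : ℂ} (A : IrrVOSA c) (h q : ℂ) extends
    VOSAModule A.toVOSA (Irr c h q) where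
  Y_tauP : ∀ (k : ℤ) (w : Irr c h q), Y A.tauP (k + 1) w = UNS.Gp k • w
  Y_tauM : ∀ (k : ℤ) (w : Irr c h q), Y A.tauM (k + 1) w = UNS.Gm k • w
  Y_mu : ∀ (n : ℤ) (w : Irr c h q), Y A.mu n w = UNS.J n • w
  Y_omega : ∀ (n : ℤ) (w : Irr c h q), Y A.omega (n + 1) w = UNS.L n • w

/-! ### Parameters of the unitary minimal series -/

/-- `c_m = 3m/(m+2)` -/
def cMin (m : ℕ) : ℂ := 3 * (m : ℂ) / (m + 2)

/-- `{1/2, 3/2, 5/2, …}` -/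
def halfNat : Set ℚ := {j | ∃ n : ℕ, j = n + 1 / 2}

/-- `h_m^{j,k} = (jk - 1/4)/(m+2)` -/
def hMin (m : ℕ) (j k : ℚ) : ℂ := ((j : ℂ) * k - 1 / 4) / (m + 2)

/-- `q_m^{j,k} = (j - k)/(m+2)` -/
def qMin (m : ℕ) (j k : ℚ) : ℂ := ((j : ℂ) - k) / (m + 2)

end NTwo

end

noncomputable section

namespace NTwo

/-! An intertwining operator `𝒴` is controlled by the series 𝒴(w₁,x)w₂ for the lowest weight vectors
w₁, w₂: weak associativity propagates vanishing from w₁ to its module, and the commutator formula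
then propagates it from w₂ (`eq_zero_of_generators`).

Let s be the sign with G^s(-1/2)w₁ = 0 and put u = G^{-s}(-1/2)w₁. Then G^s(-1/2)u = 2L(-1)w₁, and
L(-1) only differentiates 𝒴(w₁,x). Hence lowering operators map the coefficients of 𝒴(w₁,x)w₂ and
𝒴(u,x)w₂ to combinations of such coefficients. If those of weight h₃ vanish, a nonzero coefficient
of least weight would be a lowest weight vector above weight h₃, which irreducibility forbids
(`eq_zero_of_stable`, `eq_zero_of_chiral`).

So `𝒴` is determined by its two coefficients of weight h₃, both multiples of w₃. Their J(0)-charges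
differ by one, so at most one can be nonzero, and a single scalar remains (`exists_coefficient`). -/

open Module.End in
theorem _root_.Module.End.eq_zero_of_mem_eigenspace_of_mem_iSup {K W ι : Type*} [Field K]
    [AddCommGroup W] [Module K W] (f : Module.End K W) {a : K} {g : ι → K} (hg : ∀ i, g i ≠ a)
    {w : W} (hw : w ∈ eigenspace f a) (hw' : w ∈ ⨆ i, eigenspace f (g i)) : w = 0 := by
  have h := (eigenspaces_iSupIndep f) a
  rw [Submodule.disjoint_def] at h
  refine h w hw ?_
  have hle : ⨆ i, eigenspace f (g i) ≤ ⨆ j, ⨆ (_ : j ≠ a), eigenspace f j :=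
    iSup_le fun i => le_iSup₂_of_le (g i) (hg i) le_rfl
  exact hle hw'

/-! ### Relations and grading in the enveloping algebra. -/

namespace NSBasis

/-- Twice the amount by which a basis element raises the eigenvalue of `L(0)`. -/
def deg : NSBasis → ℤ
  | L n => -2 * n
  | J n => -2 * n
  | Gp k => -(2 * k + 1)
  | Gm k => -(2 * k + 1)
  | C => 0

end NSBasis

namespace UNS

theorem mk_eq {x y : NSFree} (h : NSRel x y) :
    RingQuot.mkAlgHom ℂ NSRel x = RingQuot.mkAlgHom ℂ NSRel y :=
  RingQuot.mkAlgHom_rel ℂ h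

theorem central (x : NSBasis) : C * of x = of x * C := by
  have h := mk_eq (NSRel.central x)
  simp only [map_mul] at h
  exact h

theorem LL (m n : ℤ) : L m * L n - L n * L m
    = ((m : ℂ) - n) • L (m + n) + (if m + n = 0 then (((m : ℂ) ^ 3 - m) / 12) • C else 0) := by
  have h := mk_eq (NSRel.LL m n)
  simp only [map_mul, map_sub, map_add, map_smul, apply_ite (RingQuot.mkAlgHom ℂ NSRel),
    map_zero] at h
  exact h

theorem JJ (m n : ℤ) : J m * J n - J n * J m
    = if m + n = 0 then ((m : ℂ) / 3) • C else 0 := by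
  have h := mk_eq (NSRel.JJ m n)
  simp only [map_mul, map_sub, map_smul, apply_ite (RingQuot.mkAlgHom ℂ NSRel), map_zero] at h
  exact h

theorem LJ (m n : ℤ) : L m * J n - J n * L m = (-(n : ℂ)) • J (m + n) := by
  have h := mk_eq (NSRel.LJ m n)
  simp only [map_mul, map_sub, map_smul] at h
  exact h

/-- `G true k` is `G⁺_{k + 1/2}` and `G false k` is `G⁻_{k + 1/2}`. -/
def G (s : Bool) (k : ℤ) : UNS := bif s then Gp k else Gm k

/-- The charge of `G⁺` or `G⁻`. -/
def charge (s : Bool) : ℂ := bif s then 1 else -1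

theorem LG (s : Bool) (m k : ℤ) :
    L m * G s k - G s k * L m = ((m : ℂ) / 2 - (k + 1 / 2)) • G s (m + k) := by
  cases s
  · have h := mk_eq (NSRel.LGm m k)
    simp only [map_mul, map_sub, map_smul] at h
    exact h
  · have h := mk_eq (NSRel.LGp m k)
    simp only [map_mul, map_sub, map_smul] at h
    exact h

theorem JG (s : Bool) (m k : ℤ) : J m * G s k - G s k * J m = charge s • G s (m + k) := by
  cases s
  · have h := mk_eq (NSRel.JGm m k)
    simp only [map_mul, map_sub, map_neg] at h
    exact h.trans (neg_one_smul ℂ (Gm (m + k))).symm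
  · have h := mk_eq (NSRel.JGp m k)
    simp only [map_mul, map_sub] at h
    exact h.trans (one_smul ℂ (Gp (m + k))).symm

theorem GG (s : Bool) (k l : ℤ) : G s k * G s l + G s l * G s k = 0 := by
  cases s
  · have h := mk_eq (NSRel.GmGm k l)
    simp only [map_mul, map_add, map_zero] at h
    exact h
  · have h := mk_eq (NSRel.GpGp k l)
    simp only [map_mul, map_add, map_zero] at h
    exact h

theorem GG_not (s : Bool) (k l : ℤ) : G s k * G (!s) l + G (!s) l * G s k
    = (2 : ℂ) • L (k + l + 1) + (charge s * ((k : ℂ) - l)) • J (k + l + 1) +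
        (if k + l + 1 = 0 then ((((k : ℂ) + 1 / 2) ^ 2 - 1 / 4) / 3) • C else 0) := by
  have key (k l : ℤ) : Gp k * Gm l + Gm l * Gp k
      = (2 : ℂ) • L (k + l + 1) + ((k : ℂ) - l) • J (k + l + 1) +
        (if k + l + 1 = 0 then ((((k : ℂ) + 1 / 2) ^ 2 - 1 / 4) / 3) • C else 0) := by
    have h := mk_eq (NSRel.GpGm k l)
    simp only [map_mul, map_add, map_smul, apply_ite (RingQuot.mkAlgHom ℂ NSRel), map_zero] at h
    exact h
  cases s
  · have h := key l k
    have e : l + k + 1 = k + l + 1 := by ring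
    rw [e] at h
    simp only [G, charge, Bool.not_false, cond_true, cond_false]
    rw [add_comm, h]
    congr 1
    · congr 2; ring
    · split_ifs with h0
      -- The central term survives only when l + 1/2 = -(k + 1/2), and it depends on the square, so
      -- exchanging k and l preserves it.
      · have : (l : ℂ) = -k - 1 := by
          have : l = -k - 1 := by omega
          subst this; push_cast; ring
        rw [this]; congr 2; ring
      · rfl
  · simpa [G, charge] using key k l

/-- The superbracket of two basis elements is a combination of basis elements; `ε` is its sign. -/
theorem exists_superbracket_mem_span (x y : NSBasis) :
    ∃ ε : ℂ, of x * of y - ε • (of y * of x) ∈ Submodule.span ℂ (Set.range of) := by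
  have hs (z : NSBasis) : of z ∈ Submodule.span ℂ (Set.range of) :=
    Submodule.subset_span ⟨z, rfl⟩
  have hL (n) : L n ∈ Submodule.span ℂ (Set.range of) := hs _
  have hJ (n) : J n ∈ Submodule.span ℂ (Set.range of) := hs _
  have hC : C ∈ Submodule.span ℂ (Set.range of) := hs _
  have hG (s n) : G s n ∈ Submodule.span ℂ (Set.range of) := by
    cases s <;> exact hs _
  have hite (P : Prop) [Decidable P] (t : ℂ) :
      (if P then t • C else 0) ∈ Submodule.span ℂ (Set.range of) := by
    split_ifs
    · exact Submodule.smul_mem _ _ hC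
    · exact zero_mem _
  have swap {a b : UNS} (h : a * b - b * a ∈ Submodule.span ℂ (Set.range of)) :
      b * a - (1 : ℂ) • (a * b) ∈ Submodule.span ℂ (Set.range of) := by
    rw [one_smul, ← neg_sub]; exact neg_mem h
  have bGG (s t k l) : G s k * G t l - (-1 : ℂ) • (G t l * G s k)
      ∈ Submodule.span ℂ (Set.range of) := by
    have e : (-1 : ℂ) • (G t l * G s k) = -(G t l * G s k) := neg_one_smul ℂ (G t l * G s k)
    rw [e, sub_neg_eq_add]
    rcases Bool.eq_or_eq_not t s with rfl | rfl
    · rw [GG]; exact zero_mem _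
    · rw [GG_not]
      exact add_mem (add_mem (Submodule.smul_mem _ _ (hL _)) (Submodule.smul_mem _ _ (hJ _)))
        (hite _ _)
  have bLL (m n) : L m * L n - (1 : ℂ) • (L n * L m) ∈ Submodule.span ℂ (Set.range of) := by
    rw [one_smul, LL]; exact add_mem (Submodule.smul_mem _ _ (hL _)) (hite _ _)
  have bJJ (m n) : J m * J n - (1 : ℂ) • (J n * J m) ∈ Submodule.span ℂ (Set.range of) := by
    rw [one_smul, JJ]; exact hite _ _
  have bLJ (m n) : L m * J n - J n * L m ∈ Submodule.span ℂ (Set.range of) := by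
    rw [LJ]; exact Submodule.smul_mem _ _ (hJ _)
  have bLG (s m n) : L m * G s n - G s n * L m ∈ Submodule.span ℂ (Set.range of) := by
    rw [LG]; exact Submodule.smul_mem _ _ (hG _ _)
  have bJG (s m n) : J m * G s n - G s n * J m ∈ Submodule.span ℂ (Set.range of) := by
    rw [JG]; exact Submodule.smul_mem _ _ (hG _ _)
  have bC (z) : C * of z - of z * C ∈ Submodule.span ℂ (Set.range of) := by
    rw [central, sub_self]; exact zero_mem _
  have one {a b : UNS} (h : a * b - b * a ∈ Submodule.span ℂ (Set.range of)) :
      a * b - (1 : ℂ) • (b * a) ∈ Submodule.span ℂ (Set.range of) := by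
    rwa [one_smul]
  rcases x with m | m | m | m | _
  case C => exact ⟨1, one (bC y)⟩
  all_goals rcases y with n | n | n | n | _
  case L.C => exact ⟨1, swap (bC _)⟩
  case J.C => exact ⟨1, swap (bC _)⟩
  case Gp.C => exact ⟨1, swap (bC _)⟩
  case Gm.C => exact ⟨1, swap (bC _)⟩
  case L.L => exact ⟨1, bLL m n⟩
  case L.J => exact ⟨1, one (bLJ m n)⟩
  case L.Gp => exact ⟨1, one (bLG true m n)⟩
  case L.Gm => exact ⟨1, one (bLG false m n)⟩
  case J.L => exact ⟨1, swap (bLJ n m)⟩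
  case J.J => exact ⟨1, bJJ m n⟩
  case J.Gp => exact ⟨1, one (bJG true m n)⟩
  case J.Gm => exact ⟨1, one (bJG false m n)⟩
  case Gp.L => exact ⟨1, swap (bLG true n m)⟩
  case Gp.J => exact ⟨1, swap (bJG true n m)⟩
  case Gp.Gp => exact ⟨-1, bGG true true m n⟩
  case Gp.Gm => exact ⟨-1, bGG true false m n⟩
  case Gm.L => exact ⟨1, swap (bLG false n m)⟩
  case Gm.J => exact ⟨1, swap (bJG false n m)⟩
  case Gm.Gp => exact ⟨-1, bGG false true m n⟩
  case Gm.Gm => exact ⟨-1, bGG false false m n⟩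

theorem L_zero_mul_of (x : NSBasis) :
    L 0 * of x = of x * L 0 + ((x.deg : ℂ) / 2) • of x := by
  rw [← sub_eq_iff_eq_add']
  rcases x with n | n | n | n | _
  · have h := LL 0 n
    simp only [zero_add, Int.cast_zero] at h
    refine h.trans ?_
    -- The central coefficient m³ - m is zero at m = 0, whether or not n = 0.
    have : (if n = 0 then (((0 : ℂ) ^ 3 - 0) / 12) • C else 0) = 0 := by
      split_ifs <;> simp
    rw [this, add_zero]
    congr 1
    simp only [NSBasis.deg]; push_cast; ring
  · have h := LJ 0 n
    rw [zero_add] at h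
    refine h.trans ?_
    congr 1
    simp only [NSBasis.deg]; push_cast; ring
  · have h := LG true 0 n
    rw [zero_add] at h
    refine h.trans ?_
    congr 1
    simp only [NSBasis.deg]; push_cast; ring
  · have h := LG false 0 n
    rw [zero_add] at h
    refine h.trans ?_
    congr 1
    simp only [NSBasis.deg]; push_cast; ring
  · have h : L 0 * of NSBasis.C - of NSBasis.C * L 0 = 0 :=
      sub_eq_zero.2 (central (NSBasis.L 0)).symm
    rw [h]
    simp [NSBasis.deg]

theorem induction_on {p : UNS → Prop} (a : UNS) (hc : ∀ t : ℂ, p (algebraMap ℂ UNS t))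
    (hof : ∀ x, p (of x)) (hmul : ∀ a b, p a → p b → p (a * b))
    (hadd : ∀ a b, p a → p b → p (a + b)) : p a := by
  obtain ⟨a, rfl⟩ := RingQuot.mkAlgHom_surjective ℂ NSRel a
  induction a using FreeAlgebra.induction with
  | grade0 t => rw [AlgHom.commutes]; exact hc t
  | grade1 x => exact hof x
  | mul a b ha hb => rw [map_mul]; exact hmul _ _ ha hb
  | add a b ha hb => rw [map_add]; exact hadd _ _ ha hb

/-! ### Lowest weight vectors and the submodules they generate. -/

variable {W : Type*} [AddCommGroup W] [Module ℂ W] [Module UNS W] [IsScalarTower ℂ UNS W]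

/-- A subspace that is stable under the basis elements is a submodule. -/
def submoduleOfStable (T : Submodule ℂ W) (hT : ∀ x, ∀ w ∈ T, of x • w ∈ T) :
    Submodule UNS W where
  __ := T.toAddSubmonoid
  smul_mem' a := by
    have : ∀ w ∈ T, a • w ∈ T := by
      induction a using induction_on with
      | hc t => intro w hw; rw [algebraMap_smul]; exact T.smul_mem t hw
      | hof x => exact hT x
      | hmul a b ha hb => intro w hw; rw [mul_smul]; exact ha _ (hb w hw)
      | hadd a b ha hb => intro w hw; rw [add_smul]; exact add_mem (ha w hw) (hb w hw)
    exact fun {w} hw => this w hw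

@[simp] theorem mem_submoduleOfStable {T : Submodule ℂ W}
    {hT : ∀ x, ∀ w ∈ T, of x • w ∈ T} {w : W} : w ∈ submoduleOfStable T hT ↔ w ∈ T :=
  Iff.rfl

/-- `C` is a commutator of modes of `J`, so it need not be checked for stability. -/
theorem of_smul_mem {T : Submodule ℂ W} (hL : ∀ n, ∀ w ∈ T, L n • w ∈ T)
    (hJ : ∀ n, ∀ w ∈ T, J n • w ∈ T) (hG : ∀ s k, ∀ w ∈ T, G s k • w ∈ T) (x : NSBasis) (w : W)
    (hw : w ∈ T) : of x • w ∈ T := by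
  rcases x with n | n | n | n | _
  · exact hL n w hw
  · exact hJ n w hw
  · exact hG true n w hw
  · exact hG false n w hw
  · have h : of NSBasis.C = (3 : ℂ) • (J 1 * J (-1) - J (-1) * J 1) := by
      rw [JJ]; simp [smul_smul]; rfl
    rw [h, smul_assoc, sub_smul, mul_smul, mul_smul]
    exact T.smul_mem _ (sub_mem (hJ _ _ (hJ _ _ hw)) (hJ _ _ (hJ _ _ hw)))

/-- The operator by which an element of the enveloping algebra acts. -/
abbrev act (W : Type*) [AddCommGroup W] [Module ℂ W] [Module UNS W] [IsScalarTower ℂ UNS W]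
    (a : UNS) : Module.End ℂ W :=
  Algebra.lsmul ℂ ℂ W a

theorem of_smul_mem_eigenspace (x : NSBasis) {a : ℂ} {w : W}
    (hw : w ∈ Module.End.eigenspace (act W (L 0)) a) :
    of x • w ∈ Module.End.eigenspace (act W (L 0)) (a + x.deg / 2) := by
  rw [Module.End.mem_eigenspace_iff] at hw ⊢
  simp only [Algebra.lsmul_coe] at hw ⊢
  rw [← mul_smul, L_zero_mul_of, add_smul, mul_smul, hw, smul_assoc, add_smul, smul_comm]

/-- Lowest weight vectors of `L(0)`-weight `a`. -/
structure IsLowest (v : W) (a : ℂ) : Prop where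
  weight : L 0 • v = a • v
  charge : ∃ q : ℂ, J 0 • v = q • v
  center : ∃ c : ℂ, C • v = c • v
  lower : ∀ x : NSBasis, x.deg < 0 → of x • v = 0

/-- The vectors obtained from `v` by applying raising basis elements. -/
inductive Raised (v : W) : W → Prop
  | base : Raised v v
  | step (x : NSBasis) (hx : 0 < x.deg) (w : W) (hw : Raised v w) : Raised v (of x • w)

-- Odd basis elements have odd `deg`, so degree zero leaves only L(0), J(0) and C, for which v is an
-- eigenvector.
omit [IsScalarTower ℂ UNS W] in
theorem IsLowest.of_smul {v : W} {a : ℂ} (hv : IsLowest v a) (x : NSBasis) (hx : x.deg ≤ 0) :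
    ∃ t : ℂ, of x • v = t • v := by
  rcases hx.lt_or_eq with h | h
  · exact ⟨0, by rw [hv.lower x h, zero_smul]⟩
  · rcases x with n | n | n | n | _ <;> simp only [NSBasis.deg] at h
    · obtain rfl : n = 0 := by omega
      exact ⟨a, hv.weight⟩
    · obtain rfl : n = 0 := by omega
      exact hv.charge
    · omega
    · omega
    · exact hv.center

/-- A weak form of the Poincaré-Birkhoff-Witt theorem: y is moved past the outermost raising element
x, and the superbracket is again a combination of basis elements, which act on a shorter word. The
induction therefore runs over all y at once. -/
theorem IsLowest.of_smul_mem_span_raised {v : W} {a : ℂ} (hv : IsLowest v a) {w : W}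
    (hw : Raised v w) (y : NSBasis) :
    of y • w ∈ Submodule.span ℂ {w | Raised v w} := by
  induction hw generalizing y with
  | base =>
    rcases le_or_gt y.deg 0 with h | h
    · obtain ⟨t, ht⟩ := hv.of_smul y h
      rw [ht]
      exact Submodule.smul_mem _ _ (Submodule.subset_span Raised.base)
    · exact Submodule.subset_span (Raised.step y h _ Raised.base)
  | step x hx w hw ih =>
    have hstep : ∀ u ∈ Submodule.span ℂ {w | Raised v w},
        of x • u ∈ Submodule.span ℂ {w | Raised v w} := by
      intro u hu
      induction hu using Submodule.span_induction with
      | mem u hu => exact Submodule.subset_span (Raised.step x hx u hu)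
      | zero => rw [smul_zero]; exact zero_mem _
      | add u u' _ _ h h' => rw [smul_add]; exact add_mem h h'
      | smul t u _ h => rw [smul_comm]; exact Submodule.smul_mem _ _ h
    obtain ⟨ε, hε⟩ := exists_superbracket_mem_span y x
    have hbr : ∀ b ∈ Submodule.span ℂ (Set.range of),
        b • w ∈ Submodule.span ℂ {w | Raised v w} := by
      intro b hb
      induction hb using Submodule.span_induction with
      | mem b hb => obtain ⟨z, rfl⟩ := hb; exact ih z
      | zero => rw [zero_smul]; exact zero_mem _
      | add b b' _ _ h h' => rw [add_smul]; exact add_mem h h'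
      | smul t b _ h => rw [smul_assoc]; exact Submodule.smul_mem _ _ h
    have h := hbr _ hε
    rw [sub_smul, smul_assoc, mul_smul, mul_smul] at h
    simpa using add_mem h (Submodule.smul_mem _ ε (hstep _ (ih y)))

theorem IsLowest.raised_weight {v : W} {a : ℂ} (hv : IsLowest v a) {w : W} (hw : Raised v w) :
    w = v ∨ ∃ d : ℕ, w ∈ Module.End.eigenspace (act W (L 0)) (a + ((d + 1 : ℕ) : ℂ) / 2) := by
  induction hw with
  | base => exact Or.inl rfl
  | step x hx w hw ih =>
    right
    rcases ih with rfl | ⟨d, hd⟩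
    · have h := of_smul_mem_eigenspace x (a := a) (w := w)
        (Module.End.mem_eigenspace_iff.2 hv.weight)
      -- The index d stands for the shift (d + 1)/2, which keeps the weight strictly above a.
      refine ⟨(x.deg - 1).toNat, ?_⟩
      have e : (((x.deg - 1).toNat + 1 : ℕ) : ℂ) = x.deg := by
        have : (((x.deg - 1).toNat + 1 : ℕ) : ℤ) = x.deg := by omega
        exact_mod_cast this
      rwa [e]
    · have h := of_smul_mem_eigenspace x hd
      refine ⟨d + x.deg.toNat, ?_⟩
      have e : ((d + x.deg.toNat + 1 : ℕ) : ℂ) = ((d + 1 : ℕ) : ℂ) + x.deg := by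
        have : ((d + x.deg.toNat + 1 : ℕ) : ℤ) = ((d + 1 : ℕ) : ℤ) + x.deg := by push_cast; omega
        exact_mod_cast this
      rwa [e, add_div, ← add_assoc]

/-- Raising words span a submodule containing v, and all of them except v itself have weight above
a. This triangularity is the source of the later uniqueness statements. -/
theorem IsLowest.span_le {v : W} {a : ℂ} (hv : IsLowest v a) {w : W}
    (hw : w ∈ Submodule.span UNS {v}) :
    ∃ t : ℂ, w - t • v ∈
      ⨆ d : ℕ, Module.End.eigenspace (act W (L 0)) (a + ((d + 1 : ℕ) : ℂ) / 2) := by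
  let P := submoduleOfStable (Submodule.span ℂ {w | Raised v w}) (fun x w hw => by
    induction hw using Submodule.span_induction with
    | mem u hu => exact hv.of_smul_mem_span_raised hu x
    | zero => rw [smul_zero]; exact zero_mem _
    | add u u' _ _ h h' => rw [smul_add]; exact add_mem h h'
    | smul t u _ h => rw [smul_comm]; exact Submodule.smul_mem _ _ h)
  have hP : Submodule.span UNS {v} ≤ P := by
    rw [Submodule.span_singleton_le_iff_mem]
    exact Submodule.subset_span (s := {w | Raised v w}) Raised.base
  have hw' : w ∈ Submodule.span ℂ {w | Raised v w} := hP hw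
  have hle : Submodule.span ℂ {w | Raised v w} ≤ Submodule.span ℂ {v} ⊔
      ⨆ d : ℕ, Module.End.eigenspace (act W (L 0)) (a + ((d + 1 : ℕ) : ℂ) / 2) := by
    rw [Submodule.span_le]
    intro u hu
    rcases hv.raised_weight hu with rfl | ⟨d, hd⟩
    · exact Submodule.mem_sup_left (Submodule.mem_span_singleton_self u)
    · exact Submodule.mem_sup_right (Submodule.mem_iSup_of_mem d hd)
  obtain ⟨y, hy, z, hz, rfl⟩ := Submodule.mem_sup.1 (hle hw')
  obtain ⟨t, rfl⟩ := Submodule.mem_span_singleton.1 hy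
  exact ⟨t, by simpa using hz⟩

/-- `w` generates an irreducible module and is a lowest weight vector of weight `(c, h, q)`. -/
structure Generates (w : W) (c h q : ℂ) : Prop where
  span_eq_top : Submodule.span UNS {w} = ⊤
  eq_bot_or_eq_top : ∀ N : Submodule UNS W, N = ⊥ ∨ N = ⊤
  L_zero : L 0 • w = h • w
  J_zero : J 0 • w = q • w
  C_smul : C • w = c • w
  L_pos : ∀ n : ℤ, 0 < n → L n • w = 0
  J_pos : ∀ n : ℤ, 0 < n → J n • w = 0
  G_nonneg : ∀ (s : Bool) (k : ℤ), 0 ≤ k → G s k • w = 0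

end UNS

/-! ### Irreducible lowest weight modules. -/

theorem Irr.smul_lowest_eq {c h q : ℂ} {a : UNS} (t : ℂ)
    (ha : a - algebraMap ℂ UNS t ∈ vermaIdeal c h q) :
    a • lowest c h q = t • lowest c h q := by
  have h1 : t • lowest c h q = algebraMap ℂ UNS t • lowest c h q :=
    (algebraMap_smul UNS t (lowest c h q)).symm
  have h2 (a : UNS) : a • lowest c h q = (maxProper c h q).mkQ ((vermaIdeal c h q).mkQ a) := by
    rw [lowest, ← map_smul, ← map_smul, smul_eq_mul, mul_one]
  rw [h1, h2, h2]
  congr 1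
  exact (Submodule.Quotient.eq _).2 ha

theorem Irr.smul_lowest_eq_zero {c h q : ℂ} {a : UNS} (ha : a ∈ vermaIdeal c h q) :
    a • lowest c h q = 0 :=
  (smul_lowest_eq 0 (by rwa [map_zero, sub_zero])).trans (zero_smul ℂ (lowest c h q))

theorem Irr.generates_lowest (c h q : ℂ) : UNS.Generates (lowest c h q) c h q where
  span_eq_top := by
    rw [eq_top_iff]
    rintro w -
    obtain ⟨w, rfl⟩ := Submodule.mkQ_surjective _ w
    obtain ⟨a, rfl⟩ := Submodule.mkQ_surjective _ w
    refine Submodule.mem_span_singleton.2 ⟨a, ?_⟩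
    rw [lowest, ← map_smul, ← map_smul, smul_eq_mul, mul_one]
  eq_bot_or_eq_top N := by
    -- A preimage that is proper is one of the submodules summed in `maxProper`, so N is zero.
    -- Properness of `maxProper` itself plays no part.
    by_cases hN : N.comap (maxProper c h q).mkQ = ⊤
    · right
      rw [eq_top_iff]
      rintro w -
      obtain ⟨w, rfl⟩ := Submodule.mkQ_surjective _ w
      have : w ∈ N.comap (maxProper c h q).mkQ := hN ▸ Submodule.mem_top
      exact this
    · left
      rw [eq_bot_iff]
      intro w hw
      obtain ⟨w, rfl⟩ := Submodule.mkQ_surjective _ w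
      have : w ∈ maxProper c h q := (le_sSup (a := N.comap (maxProper c h q).mkQ) hN) hw
      simpa using this
  L_zero := smul_lowest_eq h (Submodule.subset_span (by simp))
  J_zero := smul_lowest_eq q (Submodule.subset_span (by simp))
  C_smul := smul_lowest_eq c (Submodule.subset_span (by simp))
  L_pos n hn := smul_lowest_eq_zero (Submodule.subset_span (Or.inl (Or.inl ⟨n, hn, Or.inl rfl⟩)))
  J_pos n hn := smul_lowest_eq_zero (Submodule.subset_span (Or.inl (Or.inl ⟨n, hn, Or.inr rfl⟩)))
  G_nonneg s k hk := by
    refine smul_lowest_eq_zero (Submodule.subset_span (Or.inl (Or.inr ⟨k, hk, ?_⟩)))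
    cases s
    · exact Or.inr rfl
    · exact Or.inl rfl

namespace UNS.Generates

open UNS

variable {W : Type*} [AddCommGroup W] [Module ℂ W] [Module UNS W] [IsScalarTower ℂ UNS W]
  {w₀ : W} {c h q : ℂ} (hw₀ : Generates w₀ c h q)

include hw₀

omit [IsScalarTower ℂ UNS W] in
theorem isLowest : IsLowest w₀ h where
  weight := hw₀.L_zero
  charge := ⟨q, hw₀.J_zero⟩
  center := ⟨c, hw₀.C_smul⟩
  lower x hx := by
    rcases x with n | n | n | n | _ <;> simp only [NSBasis.deg] at hx
    · exact hw₀.L_pos n (by omega)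
    · exact hw₀.J_pos n (by omega)
    · exact hw₀.G_nonneg true n (by omega)
    · exact hw₀.G_nonneg false n (by omega)
    · omega

omit [IsScalarTower ℂ UNS W] in
theorem mem_span (w : W) : w ∈ Submodule.span UNS {w₀} := by
  rw [hw₀.span_eq_top]; exact Submodule.mem_top

/-- An eigenspace of a central element is a submodule, and this one contains the generator. -/
theorem center_smul (w : W) : C • w = c • w := by
  let T : Submodule ℂ W := Module.End.eigenspace (act _ C) c
  have hT (w) : w ∈ T ↔ C • w = c • w := Module.End.mem_eigenspace_iff
  let N := submoduleOfStable T fun x w hw => by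
    rw [hT] at hw ⊢
    rw [← mul_smul, central, mul_smul, hw, smul_comm]
  have h1 : Submodule.span UNS {w₀} ≤ N := by
    rw [Submodule.span_singleton_le_iff_mem]
    exact (hT _).2 hw₀.C_smul
  exact (hT w).1 (h1 (hw₀.mem_span w))

/-- The part of w outside the line of `w₀` has weight h and also lies in the sum of the higher
weight spaces; eigenspaces are independent, so it vanishes. -/
theorem exists_eq_smul {w : W} (hw : L 0 • w = h • w) : ∃ t : ℂ, w = t • w₀ := by
  obtain ⟨t, ht⟩ := hw₀.isLowest.span_le (hw₀.mem_span w)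
  refine ⟨t, sub_eq_zero.1 ?_⟩
  refine Module.End.eq_zero_of_mem_eigenspace_of_mem_iSup (act _ (L 0)) (a := h) ?_ ?_ ht
  · intro d
    simp [Nat.cast_add_one_ne_zero]
  · refine sub_mem (Module.End.mem_eigenspace_iff.2 hw) (Submodule.smul_mem _ _ ?_)
    exact Module.End.mem_eigenspace_iff.2 hw₀.L_zero

theorem eq_zero_of_weight {w : W} {a : ℂ} (hw : L 0 • w = a • w)
    (ha : ∀ d : ℕ, a ≠ h + d / 2) : w = 0 := by
  obtain ⟨t, ht⟩ := hw₀.isLowest.span_le (hw₀.mem_span w)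
  refine Module.End.eq_zero_of_mem_eigenspace_of_mem_iSup (act _ (L 0)) (a := a)
    (g := fun d : ℕ => h + d / 2) (fun d => (ha d).symm) (Module.End.mem_eigenspace_iff.2 hw) ?_
  rw [← sub_add_cancel w (t • w₀)]
  have hle : ⨆ d : ℕ, Module.End.eigenspace (act W (L 0)) (h + ((d + 1 : ℕ) : ℂ) / 2) ≤
      ⨆ d : ℕ, Module.End.eigenspace (act W (L 0)) (h + d / 2) :=
    iSup_le fun d => le_iSup (fun d : ℕ => Module.End.eigenspace (act W (L 0)) (h + d / 2)) (d + 1)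
  refine add_mem (hle ht) ?_
  refine Submodule.smul_mem _ _ (Submodule.mem_iSup_of_mem 0 ?_)
  exact Module.End.mem_eigenspace_iff.2 (by simpa using hw₀.L_zero)

/-- There are no lowest weight vectors other than the multiples of the generator. -/
theorem eq_zero_of_isLowest {v : W} (d : ℕ) (hv : IsLowest v (h + ((d + 1 : ℕ) : ℂ) / 2)) :
    v = 0 := by
  rcases hw₀.eq_bot_or_eq_top (Submodule.span UNS {v}) with hb | ht
  · simpa using hb
  · obtain ⟨t, ht⟩ := hv.span_le (w := w₀) (by rw [ht]; exact Submodule.mem_top)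
    -- If v generated the module, all weights would exceed h, including that of `w₀`.
    have h0 : w₀ = 0 := by
      refine Module.End.eq_zero_of_mem_eigenspace_of_mem_iSup (act _ (L 0)) (a := h)
        (g := fun d : ℕ => h + ((d + 1 : ℕ) : ℂ) / 2) (fun d => ?_)
        (Module.End.mem_eigenspace_iff.2 hw₀.L_zero) ?_
      · simp [Nat.cast_add_one_ne_zero]
      · rw [← sub_add_cancel w₀ (t • v)]
        have hle : ⨆ e : ℕ, Module.End.eigenspace (act W (L 0))
              (h + ((d + 1 : ℕ) : ℂ) / 2 + ((e + 1 : ℕ) : ℂ) / 2) ≤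
            ⨆ e : ℕ, Module.End.eigenspace (act W (L 0)) (h + ((e + 1 : ℕ) : ℂ) / 2) := by
          refine iSup_le fun e => le_iSup_of_le (d + e + 1) (le_of_eq ?_)
          congr 1
          push_cast; ring
        exact add_mem (hle ht) (Submodule.smul_mem _ _ (Submodule.mem_iSup_of_mem d
          (Module.End.mem_eigenspace_iff.2 hv.weight)))
    have := hw₀.mem_span v
    rw [h0, Submodule.span_zero_singleton] at this
    simpa using this

/-- A graded family of charged vectors that is stable under the lowering basis elements vanishes if
it vanishes in the lowest weight. -/
theorem eq_zero_of_stable (X : ℂ → Set W)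
    (hw : ∀ a, ∀ v ∈ X a, L 0 • v = a • v) (hq : ∀ a, ∀ v ∈ X a, ∃ q' : ℂ, J 0 • v = q' • v)
    (hX : ∀ a, ∀ v ∈ X a, ∀ x : NSBasis, x.deg < 0 →
      of x • v ∈ Submodule.span ℂ (X (a + x.deg / 2)))
    (h0 : ∀ v ∈ X h, v = 0) (a : ℂ) (v : W) (hv : v ∈ X a) : v = 0 := by
  have key : ∀ d : ℕ, ∀ v ∈ X (h + d / 2), v = 0 := by
    intro d
    induction d using Nat.strong_induction_on with
    | _ d ih =>
      intro v hv
      rcases d with _ | d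
      · exact h0 v (by simpa using hv)
      refine hw₀.eq_zero_of_isLowest d
        ⟨hw _ v hv, hq _ v hv, ⟨c, hw₀.center_smul v⟩, fun x hx => ?_⟩
      have h1 := hX _ v hv x hx
      suffices h2 : ∀ u ∈ X (h + ((d + 1 : ℕ) : ℂ) / 2 + x.deg / 2), u = 0 by
        have : Submodule.span ℂ (X (h + ((d + 1 : ℕ) : ℂ) / 2 + x.deg / 2)) ≤ ⊥ :=
          Submodule.span_le.2 h2
        simpa using this h1
      intro u hu
      -- A lowered vector either has a smaller weight in h + ½ℕ, where induction applies, or lies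
      -- below h, where there are no weights.
      by_cases hd : 0 ≤ (d : ℤ) + 1 + x.deg
      · obtain ⟨e, he⟩ := Int.eq_ofNat_of_zero_le hd
        refine ih e (by omega) u ?_
        have he' : (d : ℂ) + 1 + x.deg = e := by exact_mod_cast he
        rw [← he', add_div, ← add_assoc]
        simpa using hu
      · refine hw₀.eq_zero_of_weight (hw _ u hu) fun e he => hd ?_
        have : (d : ℂ) + 1 + x.deg = e := by
          push_cast at he ⊢
          linear_combination 2 * he
        have : (d : ℤ) + 1 + x.deg = e := by exact_mod_cast this
        omega
  by_cases ha : ∃ d : ℕ, a = h + d / 2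
  · obtain ⟨d, rfl⟩ := ha
    exact key d v hv
  · push Not at ha
    exact hw₀.eq_zero_of_weight (hw a v hv) ha

end UNS.Generates


/-! ### Parity and consequences of the Jacobi identity. -/

theorem parSign_ne_zero (i j : ZMod 2) : parSign i j ≠ 0 := pow_ne_zero _ (by norm_num)

namespace VOSAModule

variable {V W : Type*} [AddCommGroup V] [Module ℂ V] [AddCommGroup W] [Module ℂ W] {A : VOSA V}
  (M : VOSAModule A W)

theorem sup_par : M.par 0 ⊔ M.par 1 = ⊤ := M.isCompl_par.sup_eq_top

/-- Linear statements need only be checked on homogeneous vectors. -/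
theorem le_of_par_le {T : Submodule ℂ W} (h : ∀ j, M.par j ≤ T) (w : W) : w ∈ T := by
  have : (⊤ : Submodule ℂ W) ≤ T := by
    rw [← M.sup_par]
    exact sup_le (h 0) (h 1)
  exact this Submodule.mem_top

/-- If the homogeneous components of eigenvectors of an even operator are determined up to scalars,
the eigenvectors are homogeneous. -/
theorem exists_mem_par {u : V} (hu : u ∈ A.par 0) (n : ℤ) {w : W} {a : ℂ} (hw : M.Y u n w = a • w)
    (h : ∀ w', M.Y u n w' = a • w' → ∃ t : ℂ, w' = t • w) : ∃ j, w ∈ M.par j := by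
  have hsup : w ∈ M.par 0 ⊔ M.par 1 := M.sup_par ▸ Submodule.mem_top
  obtain ⟨x, hx, y, hy, rfl⟩ := Submodule.mem_sup.1 hsup
  have hx' : M.Y u n x ∈ M.par 0 := by simpa using M.par_Y 0 0 u x n hu hx
  have hy' : M.Y u n y ∈ M.par 1 := by simpa using M.par_Y 0 1 u y n hu hy
  have hxa : M.Y u n x = a • x := by
    rw [map_add, smul_add] at hw
    -- The two sides have opposite parities, so both are zero and each component is itself an
    -- eigenvector.
    have e : M.Y u n x - a • x = a • y - M.Y u n y := by
      rw [sub_eq_sub_iff_add_eq_add, hw, add_comm]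
    have h0 : M.Y u n x - a • x ∈ M.par 0 := sub_mem hx' (Submodule.smul_mem _ _ hx)
    have h1 : M.Y u n x - a • x ∈ M.par 1 := e ▸ sub_mem (Submodule.smul_mem _ _ hy) hy'
    exact sub_eq_zero.1 (Submodule.disjoint_def.1 M.isCompl_par.disjoint _ h0 h1)
  obtain ⟨t, ht⟩ := h x hxa
  by_cases h0 : t = 0
  · refine ⟨1, ?_⟩
    rw [h0, zero_smul] at ht
    rwa [ht, zero_add]
  · refine ⟨0, ?_⟩
    have : x + y = t⁻¹ • x := by
      conv_rhs => rw [ht]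
      rw [smul_smul, inv_mul_cancel₀ h0, one_smul]
    rw [this]
    exact Submodule.smul_mem _ _ hx

end VOSAModule

namespace IsIntertwining

variable {V W₁ W₂ W₃ : Type*} [AddCommGroup V] [Module ℂ V]
  [AddCommGroup W₁] [Module ℂ W₁] [AddCommGroup W₂] [Module ℂ W₂] [AddCommGroup W₃] [Module ℂ W₃]
  {A : VOSA V} {M₁ : VOSAModule A W₁} {M₂ : VOSAModule A W₂} {M₃ : VOSAModule A W₃}
  {𝒴 : W₁ →ₗ[ℂ] ℂ → W₂ →ₗ[ℂ] W₃} (h𝒴 : IsIntertwining M₁ M₂ M₃ 𝒴)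
  {i j : ZMod 2} {u : V} {w₁ : W₁} {w₂ : W₂}

include h𝒴

/-- This is the Jacobi identity at r = 0, where the binomials on the left vanish beyond the first.
-/
theorem commutator (hu : u ∈ A.par i) (hw₁ : w₁ ∈ M₁.par j) (w₂ : W₂) (p : ℤ) (k : ℂ) :
    M₃.Y u p (𝒴 w₁ k w₂) - parSign i j • 𝒴 w₁ k (M₂.Y u p w₂)
      = ∑ᶠ l : ℕ, (Ring.choose p l : ℂ) • 𝒴 (M₁.Y u l w₁) (k + p - l) w₂ := by
  have h := h𝒴.jacobi i j u w₁ w₂ hu hw₁ 0 p k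
  rw [finsum_eq_single _ 0 ?_] at h
  · simpa using h
  · intro l hl
    obtain ⟨l, rfl⟩ := Nat.exists_eq_succ_of_ne_zero hl
    rw [Int.cast_zero, Ring.choose_zero_succ]
    simp

theorem commutator_of_primary (hu : u ∈ A.par i) (hw₁ : w₁ ∈ M₁.par j)
    (hprim : ∀ l : ℕ, 2 ≤ l → M₁.Y u l w₁ = 0) (w₂ : W₂) (p : ℤ) (k : ℂ) :
    M₃.Y u p (𝒴 w₁ k w₂) = parSign i j • 𝒴 w₁ k (M₂.Y u p w₂)
      + (𝒴 (M₁.Y u 0 w₁) (k + p) w₂ + (p : ℂ) • 𝒴 (M₁.Y u 1 w₁) (k + p - 1) w₂) := by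
  rw [← sub_eq_iff_eq_add', h𝒴.commutator hu hw₁,
    finsum_eq_finsetSum_of_support_subset _ (s := Finset.range 2)]
  · simp [Finset.sum_range_succ]
  · intro l hl
    by_contra hc
    refine hl ?_
    simp only [Finset.coe_range, Set.mem_Iio, not_lt] at hc
    simp [hprim l hc]

/-- A consequence of weak associativity. -/
theorem eq_zero_of_left (hu : u ∈ A.par i) (hw₁ : w₁ ∈ M₁.par j) (h0 : ∀ k, 𝒴 w₁ k w₂ = 0)
    (n : ℤ) (k : ℂ) : 𝒴 (M₁.Y u n w₁) k w₂ = 0 := by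
  obtain ⟨P, hP⟩ := M₂.truncation u w₂
  obtain ⟨N, hN⟩ := M₁.truncation u w₁
  have key : ∀ d : ℕ, ∀ n : ℤ, N ≤ n + d → ∀ k : ℂ, 𝒴 (M₁.Y u n w₁) k w₂ = 0 := by
    intro d
    induction d with
    | zero => intro n hn k; rw [hN n (by simpa using hn)]; simp
    | succ d ih =>
      intro n hn k
      -- With p = P the modes u_{P+l} kill w₂, so the left side is zero. On the right, the terms
      -- with l > 0 contain u_{n+l}w₁, covered by descending induction on n.
      have h := h𝒴.jacobi i j u w₁ w₂ hu hw₁ n P (k - P)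
      rw [finsum_eq_zero_of_forall_eq_zero, finsum_eq_single _ 0] at h
      · simpa using h.symm
      · intro l hl
        rw [ih (n + l) (by push_cast at hn; omega), smul_zero]
      · intro l
        rw [h0, hP (P + l) (by omega)]
        simp
  exact key (N - n).toNat n (by omega) k

/-- In the commutator formula every other term applies a mode of `𝒴` to w₂ directly. Its sign
requires homogeneous w₁, whence the reduction by parity. -/
theorem eq_zero_of_right (hu : u ∈ A.par i) (h0 : ∀ w₁ k, 𝒴 w₁ k w₂ = 0) (n : ℤ) (w₁ : W₁)
    (k : ℂ) : 𝒴 w₁ k (M₂.Y u n w₂) = 0 := by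
  let T : Submodule ℂ W₁ :=
    { carrier := {w | 𝒴 w k (M₂.Y u n w₂) = 0}
      zero_mem' := by simp
      add_mem' := fun {a b} ha hb => by
        simp only [Set.mem_ofPred_eq] at ha hb ⊢
        simp [ha, hb]
      smul_mem' := fun t a ha => by
        simp only [Set.mem_ofPred_eq] at ha ⊢
        simp [ha] }
  refine M₁.le_of_par_le (T := T) (fun j w hw => ?_) w₁
  have h := h𝒴.commutator hu hw w₂ n k
  rw [finsum_eq_zero_of_forall_eq_zero (fun l => by rw [h0, smul_zero]), h0, map_zero, zero_sub,
    neg_eq_zero, smul_eq_zero] at h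
  exact h.resolve_left (parSign_ne_zero i j)

end IsIntertwining

/-- The actions of `ns(2)` on a `V`-module through the modes of `τ⁺`, `τ⁻`, `μ`, `ω`. -/
structure Compatible {V W : Type*} [AddCommGroup V] [Module ℂ V] [AddCommGroup W] [Module ℂ W]
    [Module UNS W] {A : VOSA V} (M : VOSAModule A W) (tau : Bool → V) (mu : V) : Prop where
  Y_tau : ∀ (s : Bool) (k : ℤ) (w : W), M.Y (tau s) (k + 1) w = UNS.G s k • w
  Y_mu : ∀ (n : ℤ) (w : W), M.Y mu n w = UNS.J n • w
  Y_omega : ∀ (n : ℤ) (w : W), M.Y A.omega (n + 1) w = UNS.L n • w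

section Compatible

open UNS

variable {V W : Type*} [AddCommGroup V] [Module ℂ V] [AddCommGroup W] [Module ℂ W]
    [Module UNS W] {A : VOSA V} {M : VOSAModule A W} {tau : Bool → V} {mu : V}

theorem Compatible.tau_apply (h : Compatible M tau mu) (s : Bool) (n : ℤ) (w : W) :
    M.Y (tau s) n w = G s (n - 1) • w := by
  rw [← h.Y_tau, sub_add_cancel]

theorem Compatible.omega_apply (h : Compatible M tau mu) (n : ℤ) (w : W) :
    M.Y A.omega n w = L (n - 1) • w := by
  rw [← h.Y_omega, sub_add_cancel]

/-- Closure of a subspace under modes of generators gives a submodule. -/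
theorem Compatible.of_smul_mem [IsScalarTower ℂ UNS W] (h : Compatible M tau mu)
    (htau : ∀ s, tau s ∈ A.par 1) (hmu : mu ∈ A.par 0) {T : Submodule ℂ W}
    (hT : ∀ i, ∀ u ∈ A.par i, ∀ (n : ℤ), ∀ w ∈ T, M.Y u n w ∈ T) (x : NSBasis) (w : W)
    (hw : w ∈ T) : of x • w ∈ T := by
  refine UNS.of_smul_mem (fun n w hw => ?_) (fun n w hw => ?_) (fun s k w hw => ?_) x w hw
  · rw [← h.Y_omega]; exact hT 0 _ A.omega_mem _ w hw
  · rw [← h.Y_mu]; exact hT 0 _ hmu _ w hw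
  · rw [← h.Y_tau]; exact hT 1 _ (htau s) _ w hw

end Compatible

/-! ### Reduction to generators. -/

namespace IsIntertwining

open UNS

variable {V W₁ W₂ W₃ : Type*} [AddCommGroup V] [Module ℂ V]
  [AddCommGroup W₁] [Module ℂ W₁] [Module UNS W₁] [IsScalarTower ℂ UNS W₁]
  [AddCommGroup W₂] [Module ℂ W₂] [Module UNS W₂] [IsScalarTower ℂ UNS W₂]
  [AddCommGroup W₃] [Module ℂ W₃]
  {A : VOSA V} {M₁ : VOSAModule A W₁} {M₂ : VOSAModule A W₂} {M₃ : VOSAModule A W₃}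
  {tau : Bool → V} {mu : V} (htau : ∀ s, tau s ∈ A.par 1) (hmu : mu ∈ A.par 0)
  (hM₁ : Compatible M₁ tau mu) (hM₂ : Compatible M₂ tau mu)
  {w₁ : W₁} {w₂ : W₂} {c h₁ q₁ h₂ q₂ : ℂ}
  (hw₁ : Generates w₁ c h₁ q₁) (hw₂ : Generates w₂ c h₂ q₂)
  {𝒴 : W₁ →ₗ[ℂ] ℂ → W₂ →ₗ[ℂ] W₃} (h𝒴 : IsIntertwining M₁ M₂ M₃ 𝒴)

-- L(0) is even and its lowest eigenspace is a line, so the generator is homogeneous, as the Jacobi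
-- identity demands.
include hM₁ hw₁ in
theorem _root_.NTwo.UNS.Generates.exists_mem_par :
    ∃ j, w₁ ∈ M₁.par j := by
  refine M₁.exists_mem_par A.omega_mem 1 (a := h₁) ?_ fun w hw => hw₁.exists_eq_smul ?_
  · rw [hM₁.omega_apply, sub_self, hw₁.L_zero]
  · rwa [hM₁.omega_apply, sub_self] at hw

include h𝒴 htau hmu hM₁ hM₂ hw₁ hw₂

/-- An intertwining operator is determined by its value on generators. -/
theorem eq_zero_of_generators (h0 : ∀ k, 𝒴 w₁ k w₂ = 0) : 𝒴 = 0 := by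
  obtain ⟨j, hj⟩ := hw₁.exists_mem_par hM₁
  let K : Submodule ℂ W₁ :=
    { carrier := {w | ∀ k, 𝒴 w k w₂ = 0}
      zero_mem' := by simp
      add_mem' := fun {a b} ha hb k => by simp [ha k, hb k]
      smul_mem' := fun t a ha k => by simp [ha k] }
  -- `eq_zero_of_left` needs homogeneous vectors, so K is replaced by the span of its homogeneous
  -- elements.
  let T : Submodule ℂ W₁ := (K ⊓ M₁.par 0) ⊔ (K ⊓ M₁.par 1)
  have hle : ∀ j : ZMod 2, K ⊓ M₁.par j ≤ T := fun j => by
    fin_cases j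
    · exact le_sup_left
    · exact le_sup_right
  have hstep : ∀ j : ZMod 2, ∀ i, ∀ u ∈ A.par i, ∀ (n : ℤ), ∀ w ∈ K ⊓ M₁.par j,
      M₁.Y u n w ∈ T := fun j i u hu n w hw =>
    hle (i + j) ⟨fun k => h𝒴.eq_zero_of_left hu hw.2 hw.1 n k, M₁.par_Y i j u w n hu hw.2⟩
  have hT : ∀ i, ∀ u ∈ A.par i, ∀ (n : ℤ), ∀ w ∈ T, M₁.Y u n w ∈ T := by
    intro i u hu n w hw
    obtain ⟨x, hx, y, hy, rfl⟩ := Submodule.mem_sup.1 hw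
    rw [map_add]
    exact add_mem (hstep 0 i u hu n x hx) (hstep 1 i u hu n y hy)
  have h1 : Submodule.span UNS {w₁} ≤
      submoduleOfStable T (hM₁.of_smul_mem htau hmu hT) := by
    rw [Submodule.span_singleton_le_iff_mem]
    exact hle j ⟨h0, hj⟩
  have hTK : T ≤ K := sup_le inf_le_left inf_le_left
  have h2 : ∀ w k, 𝒴 w k w₂ = 0 := fun w => hTK (h1 (hw₁.mem_span w))
  let R : Submodule ℂ W₂ :=
    { carrier := {v | ∀ w k, 𝒴 w k v = 0}
      zero_mem' := by simp
      add_mem' := fun {a b} ha hb w k => by simp [ha w k, hb w k]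
      smul_mem' := fun t a ha w k => by simp [ha w k] }
  have hR : ∀ i, ∀ u ∈ A.par i, ∀ (n : ℤ), ∀ w ∈ R, M₂.Y u n w ∈ R :=
    fun i u hu n v hv w k => h𝒴.eq_zero_of_right hu hv n w k
  have h3 : Submodule.span UNS {w₂} ≤
      submoduleOfStable R (hM₂.of_smul_mem htau hmu hR) := by
    rw [Submodule.span_singleton_le_iff_mem]
    exact h2
  have h4 : ∀ v w k, 𝒴 w k v = 0 := fun v => h3 (hw₂.mem_span v)
  ext w k v
  exact h4 v w k

end IsIntertwining


/-! ### Primary vectors and the effect of chirality. -/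

namespace UNS

theorem charge_not (s : Bool) : charge (!s) = -charge s := by
  cases s <;> simp [charge]

theorem charge_ne_zero (s : Bool) : charge s ≠ 0 := by
  cases s <;> simp [charge]

variable {W : Type*} [AddCommGroup W] [Module ℂ W] [Module UNS W] [IsScalarTower ℂ UNS W]

/-- Vectors that are primary for the even part of `ns(2)`, with weight `a` and charge `b`. -/
structure IsPrimary (w : W) (a b : ℂ) : Prop where
  L_zero : L 0 • w = a • w
  J_zero : J 0 • w = b • w
  L_pos : ∀ n : ℤ, 0 < n → L n • w = 0
  J_pos : ∀ n : ℤ, 0 < n → J n • w = 0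

omit [IsScalarTower ℂ UNS W] in
theorem Generates.isPrimary {w : W} {c h q : ℂ} (hw : Generates w c h q) : IsPrimary w h q :=
  ⟨hw.L_zero, hw.J_zero, hw.L_pos, hw.J_pos⟩

theorem L_smul_G_smul (s : Bool) (m k : ℤ) (w : W) :
    L m • G s k • w = G s k • L m • w + ((m : ℂ) / 2 - (k + 1 / 2)) • G s (m + k) • w := by
  have h := congrArg (· • w) (LG s m k)
  simp only [sub_smul, mul_smul, smul_assoc] at h ⊢
  rw [← h]; abel

theorem J_smul_G_smul (s : Bool) (m k : ℤ) (w : W) :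
    J m • G s k • w = G s k • J m • w + charge s • G s (m + k) • w := by
  have h := congrArg (· • w) (JG s m k)
  simp only [sub_smul, mul_smul, smul_assoc] at h
  rw [← h]; abel

omit [Module ℂ W] [IsScalarTower ℂ UNS W] in
theorem G_smul_G_smul (s : Bool) (k l : ℤ) (w : W) :
    G s k • G s l • w = -(G s l • G s k • w) := by
  rw [eq_neg_iff_add_eq_zero, ← mul_smul, ← mul_smul, ← add_smul, GG, zero_smul]

theorem G_smul_G_not_smul (s : Bool) (k l : ℤ) (w : W) :
    G s k • G (!s) l • w = -(G (!s) l • G s k • w) + ((2 : ℂ) • L (k + l + 1) • w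
      + (charge s * ((k : ℂ) - l)) • J (k + l + 1) • w +
        (if k + l + 1 = 0 then ((((k : ℂ) + 1 / 2) ^ 2 - 1 / 4) / 3) • C • w else 0)) := by
  have h := congrArg (· • w) (GG_not s k l)
  simp only [add_smul, mul_smul, smul_assoc, ite_smul, zero_smul] at h
  rw [mul_smul]
  rw [← h]; abel

namespace Generates

variable {w : W} {c h q : ℂ} (hw : Generates w c h q) (s : Bool)

include hw

/-- For n > 0 the brackets of L(n) and J(n) with G(-1/2) are multiples of G(n - 1/2), which kills w.
-/
theorem isPrimary_G_smul : IsPrimary (G s (-1) • w) (h + 1 / 2) (q + charge s) where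
  L_zero := by
    rw [L_smul_G_smul, hw.L_zero, smul_comm, zero_add, ← add_smul]
    norm_num
  J_zero := by
    rw [J_smul_G_smul, hw.J_zero, smul_comm, zero_add, ← add_smul]
  L_pos n hn := by
    rw [L_smul_G_smul, hw.L_pos n hn, hw.G_nonneg s _ (by omega), smul_zero, smul_zero, add_zero]
  J_pos n hn := by
    rw [J_smul_G_smul, hw.J_pos n hn, hw.G_nonneg s _ (by omega), smul_zero, smul_zero, add_zero]

omit [IsScalarTower ℂ UNS W] in
theorem G_smul_G_smul_eq_zero {k : ℤ} (hk : -1 ≤ k) : G s k • G s (-1) • w = 0 := by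
  rcases hk.eq_or_lt with rfl | hk
  · have h1 := G_smul_G_smul s (-1) (-1) w
    have : (2 : ℂ) • (G s (-1) • G s (-1) • w) = 0 := by
      rw [two_smul]; exact eq_neg_iff_add_eq_zero.1 h1
    exact (smul_eq_zero.1 this).resolve_left two_ne_zero
  · rw [G_smul_G_smul, hw.G_nonneg s k (by omega), smul_zero, neg_zero]

theorem G_smul_G_not_smul_of_pos {k : ℤ} (hk : 0 < k) : G s k • G (!s) (-1) • w = 0 := by
  rw [G_smul_G_not_smul, hw.G_nonneg s k (by omega), hw.L_pos _ (by omega), hw.J_pos _ (by omega),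
    if_neg (by omega)]
  simp

theorem G_zero_smul_G_not_smul :
    G s 0 • G (!s) (-1) • w = (2 * h + charge s * q) • w := by
  rw [G_smul_G_not_smul, hw.G_nonneg s 0 le_rfl, show (0 : ℤ) + -1 + 1 = 0 by norm_num,
    hw.L_zero, hw.J_zero]
  norm_num [add_smul, mul_smul]

-- The J-term has coefficient proportional to the difference of the two modes, here zero. Only L(-1)
-- remains, and an intertwining operator turns it into a derivative.
omit hw in
theorem G_smul_G_not_smul_of_chiral (hs : G s (-1) • w = 0) :
    G s (-1) • G (!s) (-1) • w = (2 : ℂ) • L (-1) • w := by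
  rw [G_smul_G_not_smul, hs]
  norm_num

end Generates

end UNS

/-! ### The chiral case and the dimension bound. -/

namespace IsIntertwining

open UNS

variable {V W₁ W₂ W₃ : Type*} [AddCommGroup V] [Module ℂ V]
  [AddCommGroup W₁] [Module ℂ W₁] [Module UNS W₁] [IsScalarTower ℂ UNS W₁]
  [AddCommGroup W₂] [Module ℂ W₂] [Module UNS W₂] [IsScalarTower ℂ UNS W₂]
  [AddCommGroup W₃] [Module ℂ W₃] [Module UNS W₃] [IsScalarTower ℂ UNS W₃]
  {A : VOSA V} {M₁ : VOSAModule A W₁} {M₂ : VOSAModule A W₂} {M₃ : VOSAModule A W₃}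
  {tau : Bool → V} {mu : V} (htau : ∀ s, tau s ∈ A.par 1) (hmu : mu ∈ A.par 0)
  (hM₁ : Compatible M₁ tau mu) (hM₂ : Compatible M₂ tau mu) (hM₃ : Compatible M₃ tau mu)

section Primary

variable {𝒴 : W₁ →ₗ[ℂ] ℂ → W₂ →ₗ[ℂ] W₃} (h𝒴 : IsIntertwining M₁ M₂ M₃ 𝒴)
  {w : W₁} {a b : ℂ} (hw : IsPrimary w a b) {j : ZMod 2} (hj : w ∈ M₁.par j)

include h𝒴 hM₁

omit [IsScalarTower ℂ UNS W₁] [Module UNS W₂] [IsScalarTower ℂ UNS W₂]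
  [Module UNS W₃] [IsScalarTower ℂ UNS W₃] in
theorem L_neg_one_smul (w : W₁) (n : ℂ) : 𝒴 (L (-1) • w) n = (-n) • 𝒴 w (n - 1) := by
  rw [← h𝒴.derivative, hM₁.omega_apply, zero_sub]

include hM₂ hM₃ hj

omit [IsScalarTower ℂ UNS W₁] [IsScalarTower ℂ UNS W₂] [IsScalarTower ℂ UNS W₃]

-- The modes ω₀ = L(-1) and ω₁ = L(0) contribute -(k + n + 1) and (n + 1)a. At n = 0 this gives `𝒴 w
-- k v` the weight a + wt v - k - 1, which fixes the mode indices used below.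
include hw in
theorem L_smul_apply (n : ℤ) (k : ℂ) (v : W₂) :
    L n • 𝒴 w k v = 𝒴 w k (L n • v) + ((n + 1) * a - (k + n + 1)) • 𝒴 w (k + n) v := by
  have h := h𝒴.commutator_of_primary A.omega_mem hj (fun l hl => by
    rw [hM₁.omega_apply, hw.L_pos _ (by omega)]) v (n + 1) k
  rw [hM₃.Y_omega, hM₂.Y_omega, hM₁.omega_apply, hM₁.omega_apply, zero_sub, sub_self,
    h𝒴.L_neg_one_smul hM₁, hw.L_zero] at h
  have e1 : k + ((n + 1 : ℤ) : ℂ) - 1 = k + n := by push_cast; ring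
  rw [h, e1]
  simp only [parSign, ZMod.val_zero, zero_mul, pow_zero, one_smul, map_smul, Pi.smul_apply,
    LinearMap.smul_apply, smul_smul, ← add_smul]
  congr 2
  push_cast; ring

include hw hmu in
theorem J_smul_apply (n : ℤ) (k : ℂ) (v : W₂) :
    J n • 𝒴 w k v = 𝒴 w k (J n • v) + b • 𝒴 w (k + n) v := by
  have h := h𝒴.commutator_of_primary hmu hj (fun l hl => by
    rw [hM₁.Y_mu, hw.J_pos _ (by omega)]) v n k
  rw [hM₃.Y_mu, hM₂.Y_mu, hM₁.Y_mu, hM₁.Y_mu, hw.J_zero, hw.J_pos 1 one_pos] at h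
  rw [h]
  simp [parSign]

include htau in
theorem G_smul_apply (s : Bool) (hw : ∀ l : ℤ, 0 < l → G s l • w = 0) (n : ℤ) (k : ℂ) {v : W₂}
    (hv : G s n • v = 0) :
    G s n • 𝒴 w k v = 𝒴 (G s (-1) • w) (k + n + 1) v
      + ((n : ℂ) + 1) • 𝒴 (G s 0 • w) (k + n) v := by
  have h := h𝒴.commutator_of_primary (htau s) hj (fun l hl => by
    rw [hM₁.tau_apply, hw _ (by omega)]) v (n + 1) k
  rw [hM₃.Y_tau, hM₂.Y_tau, hM₁.tau_apply, hM₁.tau_apply, hv, zero_sub, sub_self] at h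
  rw [h, map_zero, smul_zero, zero_add]
  push_cast
  congr 3 <;> ring_nf

end Primary

variable {w₁ : W₁} {w₂ : W₂} {w₃ : W₃} {c h₁ q₁ h₂ q₂ h₃ q₃ : ℂ}
  (hw₁ : Generates w₁ c h₁ q₁) (hw₂ : Generates w₂ c h₂ q₂) (hw₃ : Generates w₃ c h₃ q₃)
  (s : Bool) (hs : G s (-1) • w₁ = 0)

include htau hmu hM₁ hM₂ hM₃ hw₁ hw₂ hw₃ hs

/-- For a chiral or anti-chiral generator, two matrix coefficients determine the operator. -/
theorem eq_zero_of_chiral {𝒴 : W₁ →ₗ[ℂ] ℂ → W₂ →ₗ[ℂ] W₃} (h𝒴 : IsIntertwining M₁ M₂ M₃ 𝒴)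
    (h0 : 𝒴 w₁ (h₁ + h₂ - 1 - h₃) w₂ = 0)
    (h0' : 𝒴 (G (!s) (-1) • w₁) (h₁ + h₂ - 1 / 2 - h₃) w₂ = 0) : 𝒴 = 0 := by
  obtain ⟨j, hj⟩ := hw₁.exists_mem_par hM₁
  set u := G (!s) (-1) • w₁ with hu_def
  have hu : u ∈ M₁.par (1 + j) := by
    have h := M₁.par_Y 1 j (tau (!s)) w₁ 0 (htau _) hj
    rwa [hM₁.tau_apply, zero_sub] at h
  have hw := hw₁.isPrimary
  have huP := hw₁.isPrimary_G_smul (!s)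
  -- These are the coefficients of weight a; the indices differ by 1/2 because u has weight h₁ +
  -- 1/2.
  let X : ℂ → Set W₃ := fun a => {𝒴 w₁ (h₁ + h₂ - 1 - a) w₂, 𝒴 u (h₁ + h₂ - 1 / 2 - a) w₂}
  have hX₁ (a k : ℂ) (h : k = h₁ + h₂ - 1 - a) : 𝒴 w₁ k w₂ ∈ Submodule.span ℂ (X a) :=
    Submodule.subset_span (Or.inl (by rw [h]))
  have hX₂ (a k : ℂ) (h : k = h₁ + h₂ - 1 / 2 - a) : 𝒴 u k w₂ ∈ Submodule.span ℂ (X a) :=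
    Submodule.subset_span (Or.inr (by rw [h]; rfl))
  have hXG₁ (t : Bool) (n : ℤ) (hn : 0 ≤ n) (a : ℂ) :
      G t n • 𝒴 w₁ (h₁ + h₂ - 1 - a) w₂ ∈ Submodule.span ℂ (X (a + -(2 * n + 1) / 2)) := by
    rw [h𝒴.G_smul_apply htau hM₁ hM₂ hM₃ hj t (fun l hl => hw₁.G_nonneg t l hl.le) n _
      (hw₂.G_nonneg t n hn), hw₁.G_nonneg t 0 le_rfl]
    rcases Bool.eq_or_eq_not t s with rfl | rfl
    · rw [hs]; simp
    · rw [← hu_def]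
      refine add_mem (hX₂ _ _ (by ring)) ?_
      simp
  have hXG₂ (t : Bool) (n : ℤ) (hn : 0 ≤ n) (a : ℂ) :
      G t n • 𝒴 u (h₁ + h₂ - 1 / 2 - a) w₂ ∈ Submodule.span ℂ (X (a + -(2 * n + 1) / 2)) := by
    -- For t = s, G(-1/2)u = 2L(-1)w₁ and G(1/2)u is a multiple of w₁, so the result returns to the
    -- first family. For the opposite sign everything vanishes, since G^{-s}(-1/2) squares to zero.
    rcases Bool.eq_or_eq_not t s with rfl | rfl
    · rw [h𝒴.G_smul_apply htau hM₁ hM₂ hM₃ hu t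
        (fun l hl => hw₁.G_smul_G_not_smul_of_pos t hl) n _ (hw₂.G_nonneg t n hn),
        hw₁.G_zero_smul_G_not_smul, Generates.G_smul_G_not_smul_of_chiral t hs, map_smul 𝒴 (2 : ℂ), map_smul 𝒴 (2 * h₁ + _),
        Pi.smul_apply, LinearMap.smul_apply, h𝒴.L_neg_one_smul hM₁, Pi.smul_apply,
        LinearMap.smul_apply]
      refine add_mem (Submodule.smul_mem _ _ (Submodule.smul_mem _ _ (hX₁ _ _ (by ring)))) ?_
      exact Submodule.smul_mem _ _ (Submodule.smul_mem _ _ (hX₁ _ _ (by ring)))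
    · rw [h𝒴.G_smul_apply htau hM₁ hM₂ hM₃ hu (!s)
        (fun l hl => hw₁.G_smul_G_smul_eq_zero (!s) (by omega)) n _ (hw₂.G_nonneg (!s) n hn),
        hw₁.G_smul_G_smul_eq_zero (!s) le_rfl, hw₁.G_smul_G_smul_eq_zero (!s) (by norm_num)]
      simp
  refine h𝒴.eq_zero_of_generators htau hmu hM₁ hM₂ hw₁ hw₂ fun k => ?_
  refine hw₃.eq_zero_of_stable X ?_ ?_ ?_ ?_ (h₁ + h₂ - 1 - k) _
    (Or.inl (by rw [sub_sub_cancel]))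
  · rintro a v (rfl | rfl)
    · rw [h𝒴.L_smul_apply hM₁ hM₂ hM₃ hw hj, hw₂.L_zero, map_smul, Int.cast_zero, add_zero,
        ← add_smul]
      congr 1; ring
    · rw [h𝒴.L_smul_apply hM₁ hM₂ hM₃ huP hu, hw₂.L_zero, map_smul, Int.cast_zero, add_zero,
        ← add_smul]
      congr 1; ring
  · rintro a v (rfl | rfl)
    · rw [h𝒴.J_smul_apply hmu hM₁ hM₂ hM₃ hw hj, hw₂.J_zero, map_smul, Int.cast_zero, add_zero,
        ← add_smul]
      exact ⟨_, rfl⟩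
    · rw [h𝒴.J_smul_apply hmu hM₁ hM₂ hM₃ huP hu, hw₂.J_zero, map_smul, Int.cast_zero, add_zero,
        ← add_smul]
      exact ⟨_, rfl⟩
  · rintro a v hv x hx
    rcases x with n | n | n | n | _
    · change L n • v ∈ _
      simp only [NSBasis.deg] at hx ⊢
      rcases hv with rfl | rfl
      · rw [h𝒴.L_smul_apply hM₁ hM₂ hM₃ hw hj, hw₂.L_pos n (by omega), map_zero, zero_add]
        exact Submodule.smul_mem _ _ (hX₁ _ _ (by push_cast; ring))
      · rw [h𝒴.L_smul_apply hM₁ hM₂ hM₃ huP hu, hw₂.L_pos n (by omega), map_zero, zero_add]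
        exact Submodule.smul_mem _ _ (hX₂ _ _ (by push_cast; ring))
    · change J n • v ∈ _
      simp only [NSBasis.deg] at hx ⊢
      rcases hv with rfl | rfl
      · rw [h𝒴.J_smul_apply hmu hM₁ hM₂ hM₃ hw hj, hw₂.J_pos n (by omega), map_zero, zero_add]
        exact Submodule.smul_mem _ _ (hX₁ _ _ (by push_cast; ring))
      · rw [h𝒴.J_smul_apply hmu hM₁ hM₂ hM₃ huP hu, hw₂.J_pos n (by omega), map_zero, zero_add]
        exact Submodule.smul_mem _ _ (hX₂ _ _ (by push_cast; ring))
    · change G true n • v ∈ _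
      simp only [NSBasis.deg] at hx ⊢
      push_cast
      rcases hv with rfl | rfl
      · exact hXG₁ true n (by omega) a
      · exact hXG₂ true n (by omega) a
    · change G false n • v ∈ _
      simp only [NSBasis.deg] at hx ⊢
      push_cast
      rcases hv with rfl | rfl
      · exact hXG₁ false n (by omega) a
      · exact hXG₂ false n (by omega) a
    · simp [NSBasis.deg] at hx
  · rintro v (rfl | rfl)
    · exact h0
    · exact h0'

-- The index k selects weight h₃, whose weight space is the line of `w₃`. The coefficient has charge
-- b + q₂, so it vanishes unless this is q₃.
omit htau hw₁ hs in
omit [IsScalarTower ℂ UNS W₁] [IsScalarTower ℂ UNS W₂] in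
theorem exists_eq_smul_of_weight {𝒴 : W₁ →ₗ[ℂ] ℂ → W₂ →ₗ[ℂ] W₃}
    (h𝒴 : IsIntertwining M₁ M₂ M₃ 𝒴) {w : W₁} {a b : ℂ} (hw : IsPrimary w a b) {j : ZMod 2}
    (hj : w ∈ M₁.par j) {k : ℂ} (hk : k = a + h₂ - 1 - h₃) :
    (∃ t : ℂ, 𝒴 w k w₂ = t • w₃) ∧ (q₃ ≠ b + q₂ → 𝒴 w k w₂ = 0) := by
  have h : ∃ t : ℂ, 𝒴 w k w₂ = t • w₃ := by
    refine hw₃.exists_eq_smul ?_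
    rw [h𝒴.L_smul_apply hM₁ hM₂ hM₃ hw hj, hw₂.L_zero, map_smul, Int.cast_zero, add_zero,
      ← add_smul, hk]
    congr 1; ring
  refine ⟨h, fun hq => ?_⟩
  obtain ⟨t, ht⟩ := h
  have h1 := h𝒴.J_smul_apply hmu hM₁ hM₂ hM₃ hw hj 0 k w₂
  rw [hw₂.J_zero, map_smul, Int.cast_zero, add_zero, ← add_smul, ht, smul_comm, hw₃.J_zero,
    smul_comm, ← sub_eq_zero, ← sub_smul, ← ht] at h1
  refine (smul_eq_zero.1 h1).resolve_left fun h2 => hq ?_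
  rw [sub_eq_zero] at h2
  rw [h2, add_comm]

/-- For a chiral or anti-chiral generator, a single scalar determines the operator. -/
theorem exists_coefficient : ∃ (w : W₁) (k : ℂ), ∀ 𝒴 ∈ intertwiningOperators M₁ M₂ M₃,
    (∃ t : ℂ, 𝒴 w k w₂ = t • w₃) ∧ (𝒴 w k w₂ = 0 → 𝒴 = 0) := by
  obtain ⟨j, hj⟩ := hw₁.exists_mem_par hM₁
  have hu : G (!s) (-1) • w₁ ∈ M₁.par (1 + j) := by
    have h := M₁.par_Y 1 j (tau (!s)) w₁ 0 (htau _) hj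
    rwa [hM₁.tau_apply, zero_sub] at h
  have H₁ (𝒴) (h𝒴 : IsIntertwining M₁ M₂ M₃ 𝒴) := exists_eq_smul_of_weight hmu hM₁ hM₂ hM₃ hw₂ hw₃
    h𝒴 hw₁.isPrimary hj (k := h₁ + h₂ - 1 - h₃) rfl
  have H₂ (𝒴) (h𝒴 : IsIntertwining M₁ M₂ M₃ 𝒴) := exists_eq_smul_of_weight hmu hM₁ hM₂ hM₃ hw₂ hw₃
    h𝒴 (hw₁.isPrimary_G_smul (!s)) hu (k := h₁ + h₂ - 1 / 2 - h₃) (by ring)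
  -- The coefficients for w₁ and for G^{-s}(-1/2)w₁ have charges q₁ + q₂ and q₁ + q₂ - `charge s`;
  -- the one whose charge is not q₃ vanishes automatically.
  by_cases hq : q₃ = q₁ + q₂
  · refine ⟨w₁, h₁ + h₂ - 1 - h₃, fun 𝒴 h𝒴 => ⟨(H₁ 𝒴 h𝒴).1, fun h0 => ?_⟩⟩
    refine eq_zero_of_chiral htau hmu hM₁ hM₂ hM₃ hw₁ hw₂ hw₃ s hs h𝒴 h0 ((H₂ 𝒴 h𝒴).2 ?_)
    rw [hq, charge_not]
    intro h
    refine charge_ne_zero s ?_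
    linear_combination h
  · refine ⟨G (!s) (-1) • w₁, h₁ + h₂ - 1 / 2 - h₃, fun 𝒴 h𝒴 => ⟨(H₂ 𝒴 h𝒴).1, fun h0 => ?_⟩⟩
    exact eq_zero_of_chiral htau hmu hM₁ hM₂ hM₃ hw₁ hw₂ hw₃ s hs h𝒴 ((H₁ 𝒴 h𝒴).2 hq) h0

theorem rank_intertwiningOperators_le_one :
    Module.rank ℂ (intertwiningOperators M₁ M₂ M₃) ≤ 1 := by
  obtain ⟨w, k, H⟩ := exists_coefficient htau hmu hM₁ hM₂ hM₃ hw₁ hw₂ hw₃ s hs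
  suffices h : ∃ 𝒵, intertwiningOperators M₁ M₂ M₃ ≤ Submodule.span ℂ {𝒵} by
    obtain ⟨𝒵, h⟩ := h
    exact (Submodule.rank_mono h).trans ((rank_span_le _).trans (by simp))
  by_cases hz : ∀ 𝒴 ∈ intertwiningOperators M₁ M₂ M₃, 𝒴 = 0
  · exact ⟨0, fun 𝒴 h𝒴 => by rw [hz 𝒴 h𝒴]; exact zero_mem _⟩
  · push Not at hz
    obtain ⟨𝒵, h𝒵, hne⟩ := hz
    refine ⟨𝒵, fun 𝒴 h𝒴 => Submodule.mem_span_singleton.2 ?_⟩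
    obtain ⟨t₀, ht₀⟩ := (H 𝒵 h𝒵).1
    obtain ⟨t, ht⟩ := (H 𝒴 h𝒴).1
    have h0 : t₀ ≠ 0 := fun h0 => hne ((H 𝒵 h𝒵).2 (by rw [ht₀, h0, zero_smul]))
    -- This ratio makes the determining coefficient of 𝒴 - (t/t₀)𝒵 zero.
    refine ⟨t / t₀, (sub_eq_zero.1
      ((H _ (sub_mem h𝒴 (Submodule.smul_mem _ (t / t₀) h𝒵))).2 ?_)).symm⟩
    simp only [LinearMap.sub_apply, Pi.sub_apply, LinearMap.smul_apply, Pi.smul_apply, ht, ht₀,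
      smul_smul, div_mul_cancel₀ _ h0, sub_self]

end IsIntertwining

theorem IrrVOSAModule.compatible {c h q : ℂ} {A : IrrVOSA c} (M : IrrVOSAModule A h q) :
    Compatible M.toVOSAModule (fun s => bif s then A.tauP else A.tauM) A.mu where
  Y_tau s k w := by
    cases s
    · exact M.Y_tauM k w
    · exact M.Y_tauP k w
  Y_mu := M.Y_mu
  Y_omega := M.Y_omega

end NTwo

end

theorem mainTheorem7 (m : ℕ) (j₁ k₁ j₂ k₂ j₃ k₃ : ℚ)
    (hj₁ : j₁ ∈ NTwo.halfNat) (hk₁ : k₁ ∈ NTwo.halfNat) (hjk₁ : j₁ + k₁ < m + 2)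
    (hj₂ : j₂ ∈ NTwo.halfNat) (hk₂ : k₂ ∈ NTwo.halfNat) (hjk₂ : j₂ + k₂ < m + 2)
    (hj₃ : j₃ ∈ NTwo.halfNat) (hk₃ : k₃ ∈ NTwo.halfNat) (hjk₃ : j₃ + k₃ < m + 2)
    (A : NTwo.IrrVOSA (NTwo.cMin m))
    (M₁ : NTwo.IrrVOSAModule A (NTwo.hMin m j₁ k₁) (NTwo.qMin m j₁ k₁))
    (M₂ : NTwo.IrrVOSAModule A (NTwo.hMin m j₂ k₂) (NTwo.qMin m j₂ k₂))
    (M₃ : NTwo.IrrVOSAModule A (NTwo.hMin m j₃ k₃) (NTwo.qMin m j₃ k₃))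
    (hchiral : NTwo.IsChiral (NTwo.cMin m) (NTwo.hMin m j₁ k₁) (NTwo.qMin m j₁ k₁) ∨
      NTwo.IsAntiChiral (NTwo.cMin m) (NTwo.hMin m j₁ k₁) (NTwo.qMin m j₁ k₁)) :
    Module.rank ℂ
      (NTwo.intertwiningOperators M₁.toVOSAModule M₂.toVOSAModule M₃.toVOSAModule) ≤ 1 := by
  have hs : ∃ s, NTwo.UNS.G s (-1) •
      NTwo.Irr.lowest (NTwo.cMin m) (NTwo.hMin m j₁ k₁) (NTwo.qMin m j₁ k₁) = 0 :=
    hchiral.elim (fun h => ⟨true, h⟩) fun h => ⟨false, h⟩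
  obtain ⟨s, hs⟩ := hs
  refine NTwo.IsIntertwining.rank_intertwiningOperators_le_one (fun s => ?_) A.mu_mem
    M₁.compatible M₂.compatible M₃.compatible (NTwo.Irr.generates_lowest _ _ _)
    (NTwo.Irr.generates_lowest _ _ _) (NTwo.Irr.generates_lowest _ _ _) s hs
  cases s
  · exact A.tauM_mem
  · exact A.tauP_mem
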